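/- Let $\mathbf{k}$ be a commutative ring and let $n\ge d\ge 1$ be integers. Let $P_{n,d}$ be the set of tuples $I=(i_1<\dots<i_d)$ in $\{1,\dots,n\}$, partially ordered by $I\le J$ if and only if $i_a\le j_a$ for all $a$. *The Auslander algebra.* Let $A_{n,d}$ be the quotient of the incidence algebra $\bigoplus_{I\le J}\mathbf{k}f_{JI}$ of $P_{n,d}$ (with $f_{KJ'}f_{JI}=f_{KI}$ if $J=J'$, and $0$ otherwise) by the two-sided ideal generated by those $f_{JI}$ for which $j_a\ge i_{a+1}$ for some $1\le a<d$. *The strands algebra.* A word $w$ in the simple transpositions $s_a=(a\;a{+}1)$ of $S_d$, $1\le a<d$ (read from right to left), with associated permutation $\pi_w$, is reduced if its length equals the number of inversions of $\pi_w$. For $I,J\in P_{n,d}$ let $\hom(I,J)$ be the $\mathbf{k}$-module generated by the reduced words $w$ with $i_a\le j_{\pi_w(a)}$ for all $a$ (the strand diagrams from $I$ to $J$), modulo the relations, for words $u,v$ such that the words involved are reduced, $$u\,s_as_b\,v=-\,u\,s_bs_a\,v\quad(|a-b|>1),\qquad u\,s_as_{a+1}s_a\,v=u\,s_{a+1}s_as_{a+1}\,v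 .$$ A word with $\ell$ letters has degree $-\ell$. The composite of $w'\in\hom(J,K)$ and $w\in\hom(I,J)$ is the concatenation $w'w\in\hom(I,K)$ if that word is reduced, and $0$ otherwise. The differential is $$\partial(s_{a_1}\cdots s_{a_\ell})=\sum_{m}(-1)^{m-1}\,s_{a_1}\cdots\widehat{s_{a_m}}\cdots s_{a_\ell},$$ where the sum runs over those $m$ for which the word with the $m$-th letter deleted is reduced. Matrix multiplication makes $B_{n,d}=\bigoplus_{I,J}\hom(I,J)$ a differential graded $\mathbf{k}$-algebra. **Theorem.** The cohomology of $B_{n,d}$ is concentrated in degree $0$. The canonical morphism $B_{n,d}\to H^0(B_{n,d})$ of differential graded $\mathbf{k}$-algebras, which sends a cocycle of degree $0$ to its class and vanishes in all non-zero degrees (where $H^0(B_{n,d})$ is regarded as a differential graded algebra concentrated in degree $0$), is a quasi-isomorphism, and there is an isomorphism of (ungraded) $\mathbf{k}$-algebras $H^0(B_{n,d})\cong A_{n,d}$. -/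

import Mathlib

/-! ### Differential graded algebras -/

/-- A differential graded algebra structure, with cohomological grading, on a `k`-algebra. -/
structure DGStructure (k A : Type*) [CommRing k] [Ring A] [Algebra k A] where
  /-- The homogeneous components. -/
  gr : ℤ → Submodule k A
  /-- The differential. -/
  diff : A →ₗ[k] A
  isInternal : DirectSum.IsInternal gr
  one_mem : (1 : A) ∈ gr 0
  mul_mem : ∀ (p q : ℤ) (x y : A), x ∈ gr p → y ∈ gr q → x * y ∈ gr (p + q)
  diff_mem : ∀ (p : ℤ) (x : A), x ∈ gr p → diff x ∈ gr (p + 1)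
  diff_diff : ∀ x : A, diff (diff x) = 0
  leibniz : ∀ (p : ℤ) (x y : A), x ∈ gr p →
    diff (x * y) = diff x * y + p.negOnePow • (x * diff y)

namespace DGStructure

/-- The cocycles of degree `p`. -/
def cocycles {k A : Type*} [CommRing k] [Ring A] [Algebra k A] (D : DGStructure k A) (p : ℤ) :
    Submodule k A := D.gr p ⊓ LinearMap.ker D.diff

/-- The coboundaries of degree `p`. -/
def coboundaries {k A : Type*} [CommRing k] [Ring A] [Algebra k A] (D : DGStructure k A) (p : ℤ) :
    Submodule k A := (D.gr (p - 1)).map D.diff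

/-- The cohomology module in degree `p`. -/
abbrev cohomology {k A : Type*} [CommRing k] [Ring A] [Algebra k A] (D : DGStructure k A)
    (p : ℤ) : Type _ := D.cocycles p ⧸ (D.coboundaries p).submoduleOf (D.cocycles p)

theorem diff_one {k A : Type*} [CommRing k] [Ring A] [Algebra k A] (D : DGStructure k A) :
    D.diff 1 = 0 := by
  have := D.leibniz 0 1 1 D.one_mem
  simpa using this

/-- The cocycles of degree zero, as a subalgebra. -/
def zeroCocycles {k A : Type*} [CommRing k] [Ring A] [Algebra k A] (D : DGStructure k A) :
    Subalgebra k A where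
  carrier := D.cocycles 0
  add_mem' := fun hx hy => (D.cocycles 0).add_mem hx hy
  mul_mem' := by
    rintro x y ⟨hx, hx'⟩ ⟨hy, hy'⟩
    refine ⟨by simpa using D.mul_mem 0 0 x y hx hy, ?_⟩
    have := D.leibniz 0 x y hx
    simp only [SetLike.mem_coe, LinearMap.mem_ker] at hx' hy' ⊢
    simpa [hx', hy'] using this
  algebraMap_mem' := by
    intro r
    rw [Algebra.algebraMap_eq_smul_one]
    exact (D.cocycles 0).smul_mem r ⟨D.one_mem, D.diff_one⟩

/-- The coboundaries of degree zero, as an ideal in the algebra of cocycles of degree zero. -/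
def zeroCoboundaries {k A : Type*} [CommRing k] [Ring A] [Algebra k A] (D : DGStructure k A) :
    Ideal D.zeroCocycles where
  carrier := {z | (z : A) ∈ D.coboundaries 0}
  add_mem' := fun hx hy => (D.coboundaries 0).add_mem hx hy
  zero_mem' := (D.coboundaries 0).zero_mem
  smul_mem' := by
    rintro ⟨z, hz, hz'⟩ ⟨_, _⟩ ⟨y, hy, rfl⟩
    refine ⟨z * y, by simpa using D.mul_mem 0 _ z y hz hy, ?_⟩
    have := D.leibniz 0 z y hz
    rw [LinearMap.mem_ker.mp hz'] at this
    simpa using this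

instance {k A : Type*} [CommRing k] [Ring A] [Algebra k A] (D : DGStructure k A) :
    D.zeroCoboundaries.IsTwoSided where
  mul_mem_of_left := by
    rintro ⟨_, _⟩ ⟨z, hz, hz'⟩ ⟨y, hy, rfl⟩
    refine ⟨y * z, by simpa using D.mul_mem _ 0 y z hy hz, ?_⟩
    have := D.leibniz _ y z hy
    rw [LinearMap.mem_ker.mp hz'] at this
    simpa using this

/-- The algebra `H^0`: cocycles of degree zero modulo coboundaries of degree zero. -/
abbrev H0 {k A : Type*} [CommRing k] [Ring A] [Algebra k A] (D : DGStructure k A) : Type _ :=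
  D.zeroCocycles ⧸ D.zeroCoboundaries

theorem isInternal_of_proj {k A : Type*} [CommRing k] [AddCommGroup A] [Module k A]
    (gr : ℤ → Submodule k A) (P : ℤ → A →ₗ[k] A) (S : Finset ℤ)
    (hmem : ∀ p x, P p x ∈ gr p) (hself : ∀ p x, x ∈ gr p → P p x = x)
    (hne : ∀ p q x, p ≠ q → x ∈ gr q → P p x = 0) (hsum : ∀ x, ∑ p ∈ S, P p x = x) :
    DirectSum.IsInternal gr := by
  refine DirectSum.isInternal_submodule_of_iSupIndep_of_iSup_eq_top ?_ ?_
  · rw [iSupIndep_def]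
    intro p
    rw [Submodule.disjoint_def]
    intro x hx hx'
    have h : (⨆ (q) (_ : q ≠ p), gr q) ≤ LinearMap.ker (P p) :=
      iSup₂_le fun q hq y hy => hne p q y hq.symm hy
    rw [← hself p x hx]
    exact h hx'
  · rw [eq_top_iff]
    intro x _
    rw [← hsum x]
    exact Submodule.sum_mem _ fun p _ => Submodule.mem_iSup_of_mem p (hmem p x)

/-- An ungraded algebra as a differential graded algebra concentrated in degree zero. -/
noncomputable def concentrated (k C : Type*) [CommRing k] [Ring C] [Algebra k C] :
    DGStructure k C where
  gr p := if p = 0 then ⊤ else ⊥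
  diff := 0
  isInternal := by
    refine isInternal_of_proj _ (fun p => if p = 0 then LinearMap.id else 0) {0} ?_ ?_ ?_ ?_
    · intro p x; split_ifs <;> simp
    · intro p x hx
      split_ifs with h
      · rfl
      · rw [if_neg h] at hx; simpa using hx.symm
    · intro p q x hpq hx
      split_ifs with h
      · rw [if_neg (by omega)] at hx; simpa using hx
      · rfl
    · simp
  one_mem := by simp
  mul_mem := by
    intro p q x y hx hy
    split_ifs at * <;> first | omega | simp_all
  diff_mem := by simp
  diff_diff := by simp
  leibniz := by simp

end DGStructure

/-- A morphism of differential graded algebras. -/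
structure DGHom {k A C : Type*} [CommRing k] [Ring A] [Algebra k A] [Ring C] [Algebra k C]
    (D : DGStructure k A) (E : DGStructure k C) where
  /-- The underlying homomorphism of algebras. -/
  toAlgHom : A →ₐ[k] C
  map_gr : ∀ (p : ℤ) (x : A), x ∈ D.gr p → toAlgHom x ∈ E.gr p
  map_diff : ∀ x : A, toAlgHom (D.diff x) = E.diff (toAlgHom x)

namespace DGHom

/-- The restriction of a morphism to cocycles. -/
def mapCocycles {k A C : Type*} [CommRing k] [Ring A] [Algebra k A] [Ring C] [Algebra k C]
    {D : DGStructure k A} {E : DGStructure k C} (f : DGHom D E) (p : ℤ) :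
    D.cocycles p →ₗ[k] E.cocycles p :=
  f.toAlgHom.toLinearMap.restrict fun x hx =>
    ⟨f.map_gr p x hx.1, by
      have h : D.diff x = 0 := hx.2
      change E.diff (f.toAlgHom x) = 0
      rw [← f.map_diff, h, map_zero]⟩

/-- The map induced on cohomology. -/
def mapCohomology {k A C : Type*} [CommRing k] [Ring A] [Algebra k A] [Ring C] [Algebra k C]
    {D : DGStructure k A} {E : DGStructure k C} (f : DGHom D E) (p : ℤ) :
    D.cohomology p →ₗ[k] E.cohomology p :=
  Submodule.mapQ _ _ (f.mapCocycles p) (by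
    rintro ⟨_, _⟩ ⟨x, hx, rfl⟩
    exact ⟨f.toAlgHom x, f.map_gr _ x hx, (f.map_diff x).symm⟩)

/-- A quasi-isomorphism: the induced maps on cohomology are bijective in all degrees. -/
def IsQuasiIso {k A C : Type*} [CommRing k] [Ring A] [Algebra k A] [Ring C] [Algebra k C]
    {D : DGStructure k A} {E : DGStructure k C} (f : DGHom D E) : Prop :=
  ∀ p : ℤ, Function.Bijective (f.mapCohomology p)

end DGHom


namespace Strands

/-! ### Permutations and words in the simple transpositions -/

/-- The letters `s_1, …, s_{d-1}`, indexed from `0`: the letter `a` exchanges the positions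
`a` and `a + 1`. -/
abbrev Letter (d : ℕ) : Type := Fin (d - 1)

/-- The lower position moved by a letter. -/
def lo {d : ℕ} (a : Letter d) : Fin d := ⟨a.1, by have := a.2; omega⟩

/-- The upper position moved by a letter. -/
def hi {d : ℕ} (a : Letter d) : Fin d := ⟨a.1 + 1, by have := a.2; omega⟩

/-- The simple transposition given by a letter. -/
def simple {d : ℕ} (a : Letter d) : Equiv.Perm (Fin d) := Equiv.swap (lo a) (hi a)

/-- The permutation expressed by a word. Words are read from right to left, so that the rightmost
letter is applied first. -/
def wordPerm {d : ℕ} (w : List (Letter d)) : Equiv.Perm (Fin d) := (w.map simple).prod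

/-- The number of inversions of a permutation. -/
def inv {d : ℕ} (π : Equiv.Perm (Fin d)) : ℕ :=
  (Finset.univ.filter fun p : Fin d × Fin d => p.1 < p.2 ∧ π p.2 < π p.1).card

/-- A word is reduced if its length is the length (number of inversions) of the permutation that
it expresses; in the strand diagram of the word, no two strands cross more than once. -/
def IsReduced {d : ℕ} (w : List (Letter d)) : Prop := w.length = inv (wordPerm w)

@[simp] theorem wordPerm_nil {d : ℕ} : wordPerm ([] : List (Letter d)) = 1 := rfl

@[simp] theorem wordPerm_cons {d : ℕ} (a : Letter d) (w : List (Letter d)) :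
    wordPerm (a :: w) = simple a * wordPerm w := by simp [wordPerm]

theorem wordPerm_append {d : ℕ} (u v : List (Letter d)) :
    wordPerm (u ++ v) = wordPerm u * wordPerm v := by simp [wordPerm]

theorem simple_mul_self {d : ℕ} (a : Letter d) : simple a * simple a = 1 :=
  Equiv.swap_mul_self _ _

theorem simple_inv {d : ℕ} (a : Letter d) : (simple a)⁻¹ = simple a := Equiv.swap_inv _ _

@[simp] theorem simple_lo {d : ℕ} (a : Letter d) : simple a (lo a) = hi a :=
  Equiv.swap_apply_left _ _

@[simp] theorem simple_hi {d : ℕ} (a : Letter d) : simple a (hi a) = lo a :=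
  Equiv.swap_apply_right _ _

theorem simple_of_ne {d : ℕ} (a : Letter d) (x : Fin d) (h : x ≠ lo a) (h' : x ≠ hi a) :
    simple a x = x := Equiv.swap_apply_of_ne_of_ne h h'

theorem lo_lt_hi {d : ℕ} (a : Letter d) : lo a < hi a := by
  simp [lo, hi]

theorem simple_lt_iff {d : ℕ} (a : Letter d) (x y : Fin d)
    (h : ¬ (x = lo a ∧ y = hi a)) (h' : ¬ (x = hi a ∧ y = lo a)) :
    simple a x < simple a y ↔ x < y := by
  unfold simple
  rw [Equiv.swap_apply_def, Equiv.swap_apply_def]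
  simp only [lo, hi, Fin.ext_iff, Fin.lt_def] at *
  split_ifs <;> simp_all <;> omega

theorem inv_simple_mul {d : ℕ} (a : Letter d) (π : Equiv.Perm (Fin d))
    (h : π⁻¹ (lo a) < π⁻¹ (hi a)) : inv (simple a * π) = inv π + 1 := by
  classical
  obtain ⟨p, hp⟩ : ∃ p, π⁻¹ (lo a) = p := ⟨_, rfl⟩
  obtain ⟨q, hq⟩ : ∃ q, π⁻¹ (hi a) = q := ⟨_, rfl⟩
  rw [hp, hq] at h
  rw [Equiv.Perm.inv_eq_iff_eq] at hp hq
  have hl := lo_lt_hi a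
  unfold inv
  rw [← Finset.card_insert_of_notMem (a := (p, q))]
  · congr 1
    ext ⟨x, y⟩
    rw [Finset.mem_insert, Finset.mem_filter, Finset.mem_filter]
    simp only [Finset.mem_univ, true_and, Prod.mk.injEq, Equiv.Perm.mul_apply]
    by_cases h1 : x = p ∧ y = q
    · obtain ⟨rfl, rfl⟩ := h1
      simp [h, hl, ← hp, ← hq]
    · by_cases h2 : x = q ∧ y = p
      · obtain ⟨rfl, rfl⟩ := h2
        simp [h.ne', not_lt_of_gt h]
      · rw [simple_lt_iff]
        · simp [h1]
        · rintro ⟨e1, e2⟩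
          exact h2 ⟨π.injective (e2.trans hq), π.injective (e1.trans hp)⟩
        · rintro ⟨e1, e2⟩
          exact h1 ⟨π.injective (e2.trans hp), π.injective (e1.trans hq)⟩
  · simp [← hp, ← hq, not_lt_of_gt hl]

theorem inv_simple_mul' {d : ℕ} (a : Letter d) (π : Equiv.Perm (Fin d))
    (h : π⁻¹ (hi a) < π⁻¹ (lo a)) : inv (simple a * π) + 1 = inv π := by
  have := inv_simple_mul a (simple a * π) (by simpa [mul_inv_rev, simple_inv] using h)
  rw [← mul_assoc, simple_mul_self, one_mul] at this
  exact this.symm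

theorem inv_inv' {d : ℕ} (π : Equiv.Perm (Fin d)) : inv π⁻¹ = inv π := by
  unfold inv
  refine Finset.card_bij (fun p _ => (π⁻¹ p.2, π⁻¹ p.1)) ?_ ?_ ?_
  · rintro ⟨x, y⟩ h
    simp at h ⊢
    exact ⟨h.2, h.1⟩
  · rintro ⟨x, y⟩ _ ⟨x', y'⟩ _ h
    simp at h
    simp [h]
  · rintro ⟨x, y⟩ h
    simp at h
    exact ⟨(π y, π x), by simp [h], by simp⟩

theorem inv_one {d : ℕ} : inv (1 : Equiv.Perm (Fin d)) = 0 := by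
  rw [inv, Finset.card_eq_zero, Finset.filter_eq_empty_iff]
  rintro p - ⟨h, h'⟩
  exact lt_asymm h h'

theorem inv_simple_mul_cases {d : ℕ} (a : Letter d) (π : Equiv.Perm (Fin d)) :
    (π⁻¹ (lo a) < π⁻¹ (hi a) ∧ inv (simple a * π) = inv π + 1) ∨
    (π⁻¹ (hi a) < π⁻¹ (lo a) ∧ inv (simple a * π) + 1 = inv π) := by
  rcases lt_trichotomy (π⁻¹ (lo a)) (π⁻¹ (hi a)) with h | h | h
  · exact Or.inl ⟨h, inv_simple_mul a π h⟩
  · exact absurd (π⁻¹.injective h) (lo_lt_hi a).ne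
  · exact Or.inr ⟨h, inv_simple_mul' a π h⟩

theorem inv_mul_simple_le {d : ℕ} (a : Letter d) (π : Equiv.Perm (Fin d)) :
    inv (π * simple a) ≤ inv π + 1 := by
  rw [← inv_inv', ← inv_inv' π, mul_inv_rev, simple_inv]
  rcases inv_simple_mul_cases a π⁻¹ with h | h <;> omega

theorem inv_wordPerm_mul_le {d : ℕ} (u : List (Letter d)) (π : Equiv.Perm (Fin d)) :
    inv (wordPerm u * π) ≤ u.length + inv π := by
  induction u with
  | nil => simp
  | cons a u ih =>
    rw [wordPerm_cons, mul_assoc, List.length_cons]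
    rcases inv_simple_mul_cases a (wordPerm u * π) with h | h <;> omega

theorem inv_mul_wordPerm_le {d : ℕ} (π : Equiv.Perm (Fin d)) (v : List (Letter d)) :
    inv (π * wordPerm v) ≤ inv π + v.length := by
  induction v generalizing π with
  | nil => simp
  | cons a v ih =>
    rw [wordPerm_cons, ← mul_assoc, List.length_cons]
    have := ih (π * simple a)
    have := inv_mul_simple_le a π
    omega

theorem inv_wordPerm_le {d : ℕ} (w : List (Letter d)) : inv (wordPerm w) ≤ w.length := by
  have := inv_wordPerm_mul_le w 1
  simpa [inv_one] using this

theorem IsReduced.left {d : ℕ} {u v : List (Letter d)} (h : IsReduced (u ++ v)) :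
    IsReduced u := by
  unfold IsReduced at *
  rw [wordPerm_append, List.length_append] at h
  have := inv_mul_wordPerm_le (wordPerm u) v
  have := inv_wordPerm_le u
  omega

theorem IsReduced.right {d : ℕ} {u v : List (Letter d)} (h : IsReduced (u ++ v)) :
    IsReduced v := by
  unfold IsReduced at *
  rw [wordPerm_append, List.length_append] at h
  have := inv_wordPerm_mul_le u (wordPerm v)
  have := inv_wordPerm_le v
  omega

theorem IsReduced.length_le {d : ℕ} {w : List (Letter d)} (h : IsReduced w) :
    w.length ≤ d * d := by
  rw [h, inv]
  refine (Finset.card_le_univ _).trans ?_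
  simp

theorem isReduced_nil {d : ℕ} : IsReduced ([] : List (Letter d)) := by
  simp [IsReduced, inv_one]

theorem exists_descent {d : ℕ} (π : Equiv.Perm (Fin d))
    (h : ∀ a : Letter d, π⁻¹ (lo a) < π⁻¹ (hi a)) : π = 1 := by
  have hmono : StrictMono (π⁻¹ : Equiv.Perm (Fin d)) := by
    obtain _ | d := d
    · intro x; exact x.elim0
    · rw [Fin.strictMono_iff_lt_succ]
      intro i
      exact h ⟨i.1, by simp⟩
  have hiso : hmono.orderIsoOfSurjective _ (π⁻¹ : Equiv.Perm (Fin d)).surjective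
      = OrderIso.refl _ := Subsingleton.elim _ _
  have h2 : π⁻¹ = 1 := by
    ext x
    exact congrArg Fin.val (DFunLike.congr_fun hiso x)
  exact inv_eq_one.mp h2

theorem exists_reduced {d : ℕ} (π : Equiv.Perm (Fin d)) :
    ∃ w : List (Letter d), wordPerm w = π ∧ IsReduced w := by
  induction hn : inv π using Nat.strong_induction_on generalizing π with
  | _ m ih =>
    by_cases h : ∀ a : Letter d, π⁻¹ (lo a) < π⁻¹ (hi a)
    · exact ⟨[], (exists_descent π h).symm, isReduced_nil⟩
    · push Not at h
      obtain ⟨a, ha⟩ := h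
      have ha' : inv (simple a * π) + 1 = inv π := by
        rcases inv_simple_mul_cases a π with h | h
        · exact absurd h.1 (not_lt.mpr ha)
        · exact h.2
      obtain ⟨w, hw, hr⟩ := ih (inv (simple a * π)) (by omega) _ rfl
      have hp : wordPerm (a :: w) = π := by
        rw [wordPerm_cons, hw, ← mul_assoc, simple_mul_self, one_mul]
      refine ⟨a :: w, hp, ?_⟩
      unfold IsReduced at *
      rw [hp, List.length_cons, hr, hw, ha']

theorem simple_comm {d : ℕ} (a b : Letter d) (h : a.1 + 1 < b.1) :
    simple a * simple b = simple b * simple a := by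
  refine Equiv.Perm.Disjoint.commute ?_
  intro x
  by_cases h1 : x = lo a
  · right; apply simple_of_ne <;> simp [h1, lo, hi] <;> omega
  · by_cases h2 : x = hi a
    · right; apply simple_of_ne <;> simp [h2, lo, hi] <;> omega
    · left; exact simple_of_ne a x h1 h2

theorem hi_eq_lo {d : ℕ} (a b : Letter d) (h : a.1 + 1 = b.1) : hi a = lo b := by
  simp [hi, lo, h]

theorem simple_braid {d : ℕ} (a b : Letter d) (h : a.1 + 1 = b.1) :
    simple a * simple b * simple a = simple b * simple a * simple b := by
  have e := hi_eq_lo a b h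
  have n1 : lo a ≠ lo b := by simp [lo]; omega
  have n2 : lo a ≠ hi b := by simp [lo, hi]; omega
  have n3 : lo b ≠ hi b := (lo_lt_hi b).ne
  unfold simple
  have h1 := Equiv.swap_mul_swap_mul_swap n3.symm n2.symm
  have h2 := Equiv.swap_mul_swap_mul_swap n1 n2
  rw [e, h2, Equiv.swap_comm (hi b) (lo a), ← h1, Equiv.swap_comm (lo b) (lo a),
    Equiv.swap_comm (hi b) (lo b)]

theorem isReduced_cons {d : ℕ} (a : Letter d) (w : List (Letter d)) (h : IsReduced w)
    (ha : (wordPerm w)⁻¹ (lo a) < (wordPerm w)⁻¹ (hi a)) : IsReduced (a :: w) := by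
  unfold IsReduced at *
  rw [wordPerm_cons, inv_simple_mul a _ ha, List.length_cons, h]

theorem IsReduced.ascent {d : ℕ} {a : Letter d} {w : List (Letter d)} (h : IsReduced (a :: w)) :
    (wordPerm w)⁻¹ (lo a) < (wordPerm w)⁻¹ (hi a) := by
  have h2 : IsReduced w := IsReduced.right (u := [a]) h
  unfold IsReduced at *
  rw [wordPerm_cons, List.length_cons] at h
  rcases inv_simple_mul_cases a (wordPerm w) with h' | h'
  · exact h'.1
  · omega

theorem IsReduced.descent {d : ℕ} {a : Letter d} {w : List (Letter d)} (h : IsReduced (a :: w)) :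
    (wordPerm (a :: w))⁻¹ (hi a) < (wordPerm (a :: w))⁻¹ (lo a) := by
  have := h.ascent
  rw [wordPerm_cons, mul_inv_rev, simple_inv, Equiv.Perm.mul_apply, Equiv.Perm.mul_apply,
    simple_lo, simple_hi]
  exact this

theorem isReduced_cons_of_descent {d : ℕ} (a : Letter d) (x : List (Letter d))
    (π : Equiv.Perm (Fin d)) (h : π⁻¹ (hi a) < π⁻¹ (lo a)) (hx : IsReduced x)
    (hp : wordPerm x = simple a * π) : IsReduced (a :: x) ∧ wordPerm (a :: x) = π := by
  constructor
  · refine isReduced_cons a x hx ?_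
    rw [hp, mul_inv_rev, simple_inv, Equiv.Perm.mul_apply, Equiv.Perm.mul_apply,
      simple_lo, simple_hi]
    exact h
  · rw [wordPerm_cons, hp, ← mul_assoc, simple_mul_self, one_mul]

/-- A permutation with two distant left descents starts a reduced word with both of them. -/
theorem exists_far {d : ℕ} (a b : Letter d) (π : Equiv.Perm (Fin d)) (hab : a.1 + 1 < b.1)
    (ha : π⁻¹ (hi a) < π⁻¹ (lo a)) (hb : π⁻¹ (hi b) < π⁻¹ (lo b)) :
    ∃ x : List (Letter d), IsReduced (a :: b :: x) ∧ wordPerm (a :: b :: x) = π := by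
  obtain ⟨x, hx, hr⟩ := exists_reduced (simple b * (simple a * π))
  have h1 : simple a (hi b) = hi b := by
    apply simple_of_ne <;> simp [lo, hi] <;> omega
  have h2 : simple a (lo b) = lo b := by
    apply simple_of_ne <;> simp [lo, hi] <;> omega
  obtain ⟨r1, p1⟩ := isReduced_cons_of_descent b x (simple a * π) (by
    rw [mul_inv_rev, simple_inv, Equiv.Perm.mul_apply, Equiv.Perm.mul_apply, h1, h2]
    exact hb) hr hx
  exact ⟨x, isReduced_cons_of_descent a _ π ha r1 p1⟩

/-- A permutation with two adjacent left descents starts a reduced word with a braid in them. -/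
theorem exists_braid {d : ℕ} (a b : Letter d) (π : Equiv.Perm (Fin d)) (hab : a.1 + 1 = b.1)
    (ha : π⁻¹ (hi a) < π⁻¹ (lo a)) (hb : π⁻¹ (hi b) < π⁻¹ (lo b)) :
    ∃ x : List (Letter d), IsReduced (a :: b :: a :: x) ∧ wordPerm (a :: b :: a :: x) = π := by
  have e := hi_eq_lo a b hab
  obtain ⟨x, hx, hr⟩ := exists_reduced (simple a * (simple b * (simple a * π)))
  have h1 : simple a (hi b) = hi b := by
    apply simple_of_ne <;> simp [lo, hi] <;> omega
  have h2 : simple b (lo a) = lo a := by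
    apply simple_of_ne <;> simp [lo, hi] <;> omega
  have h3 : simple a (lo b) = lo a := by rw [← e, simple_hi]
  have h4 : simple b (hi a) = hi b := by rw [e, simple_lo]
  obtain ⟨r1, p1⟩ := isReduced_cons_of_descent a x (simple b * (simple a * π)) (by
    simp only [mul_inv_rev, simple_inv, Equiv.Perm.mul_apply, h4, h1, h2, simple_lo]
    rw [e]; exact hb) hr hx
  obtain ⟨r2, p2⟩ := isReduced_cons_of_descent b _ (simple a * π) (by
    simp only [mul_inv_rev, simple_inv, Equiv.Perm.mul_apply, h1, h3]
    exact hb.trans (e ▸ ha)) r1 p1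
  exact ⟨x, isReduced_cons_of_descent a _ π ha r2 p2⟩

/-- In a ring with elements that satisfy the far and braid relations, the products over two reduced
words of the same permutation agree up to sign. -/
theorem prod_eq_or_neg {d : ℕ} {R : Type*} [Ring R] (g : Letter d → R)
    (hf : ∀ a b : Letter d, a.1 + 1 < b.1 → g a * g b = -(g b * g a))
    (hb : ∀ a b : Letter d, a.1 + 1 = b.1 → g a * g b * g a = g b * g a * g b)
    (w w' : List (Letter d)) (hw : IsReduced w) (hw' : IsReduced w')
    (hp : wordPerm w = wordPerm w') :
    (w.map g).prod = (w'.map g).prod ∨ (w.map g).prod = -(w'.map g).prod := by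
  induction hn : w.length using Nat.strong_induction_on generalizing w w' with
  | _ m ih =>
  have hlen : w.length = w'.length := by rw [hw, hw', hp]
  rcases w with _ | ⟨a, u⟩
  · have : w' = [] := List.length_eq_zero_iff.mp (by simpa using hlen.symm)
    subst this; exact Or.inl rfl
  rcases w' with _ | ⟨b, u'⟩
  · simp at hlen
  have ru : IsReduced u := IsReduced.right (u := [a]) hw
  have ru' : IsReduced u' := IsReduced.right (u := [b]) hw'
  simp only [List.length_cons] at hn hlen
  have da := hw.descent
  have db := hw'.descent
  rw [← hp] at db
  -- the statement for two distinct first letters, in increasing order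
  have key : ∀ (a b : Letter d) (u u' : List (Letter d)), IsReduced (a :: u) →
      IsReduced (b :: u') → wordPerm (a :: u) = wordPerm (b :: u') → u.length < m →
      u'.length < m → a.1 < b.1 →
      ((a :: u).map g).prod = ((b :: u').map g).prod ∨
        ((a :: u).map g).prod = -((b :: u').map g).prod := by
    intro a b u u' hw hw' hp hu hu' hab
    have da := hw.descent
    have db := hw'.descent
    rw [← hp] at db
    have ru : IsReduced u := IsReduced.right (u := [a]) hw
    have ru' : IsReduced u' := IsReduced.right (u := [b]) hw'
    rcases Nat.lt_or_ge (a.1 + 1) b.1 with hfar | hnear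
    · obtain ⟨x, rx, px⟩ := exists_far a b _ hfar da db
      have px' : wordPerm (b :: a :: x) = wordPerm (a :: b :: x) := by
        simp only [wordPerm_cons, ← mul_assoc, simple_comm a b hfar]
      have rx' : IsReduced (b :: a :: x) := by
        unfold IsReduced at *
        rw [px', ← rx]; simp
      have e1 := ih _ hu u (b :: x) ru (IsReduced.right (u := [a]) rx) (by
        rw [wordPerm_cons, wordPerm_cons a u] at px
        exact (mul_left_cancel px).symm) rfl
      have e2 := ih _ hu' u' (a :: x) ru' (IsReduced.right (u := [b]) rx') (by
        have := px'.trans (px.trans hp)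
        rw [wordPerm_cons, wordPerm_cons b u'] at this
        exact (mul_left_cancel this).symm) rfl
      simp only [List.map_cons, List.prod_cons] at e1 e2 ⊢
      have hc : g a * (g b * (x.map g).prod) = -(g b * (g a * (x.map g).prod)) := by
        rw [← mul_assoc, hf a b hfar, neg_mul, mul_assoc]
      rcases e1 with e1 | e1 <;> rcases e2 with e2 | e2 <;> rw [e1, e2] <;> simp [hc]
    · have hbr : a.1 + 1 = b.1 := by omega
      obtain ⟨x, rx, px⟩ := exists_braid a b _ hbr da db
      have px' : wordPerm (b :: a :: b :: x) = wordPerm (a :: b :: a :: x) := by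
        simp only [wordPerm_cons, ← mul_assoc, simple_braid a b hbr]
      have rx' : IsReduced (b :: a :: b :: x) := by
        unfold IsReduced at *
        rw [px', ← rx]; simp
      have e1 := ih _ hu u (b :: a :: x) ru (IsReduced.right (u := [a]) rx) (by
        rw [wordPerm_cons, wordPerm_cons a u] at px
        exact (mul_left_cancel px).symm) rfl
      have e2 := ih _ hu' u' (a :: b :: x) ru' (IsReduced.right (u := [b]) rx') (by
        have := px'.trans (px.trans hp)
        rw [wordPerm_cons, wordPerm_cons b u'] at this
        exact (mul_left_cancel this).symm) rfl
      simp only [List.map_cons, List.prod_cons] at e1 e2 ⊢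
      have hc : g a * (g b * (g a * (x.map g).prod)) = g b * (g a * (g b * (x.map g).prod)) := by
        simp only [← mul_assoc, hb a b hbr]
      rcases e1 with e1 | e1 <;> rcases e2 with e2 | e2 <;> rw [e1, e2] <;> simp [hc]
  rcases lt_trichotomy a.1 b.1 with hab | hab | hab
  · exact key a b u u' hw hw' hp (by omega) (by omega) hab
  · have : a = b := Fin.ext hab
    subst this
    rw [wordPerm_cons, wordPerm_cons] at hp
    have := ih _ (by omega : u.length < m) u u' ru ru' (mul_left_cancel hp) rfl
    simp only [List.map_cons, List.prod_cons]
    rcases this with h | h <;> rw [h] <;> simp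
  · rcases key b a u' u hw' hw hp.symm (by omega) (by omega) hab with h | h
    · exact Or.inl h.symm
    · exact Or.inr (by rw [h, neg_neg])

/-- If moreover the elements square to zero, the product over a non-reduced word vanishes. -/
theorem prod_eq_zero {d : ℕ} {R : Type*} [Ring R] (g : Letter d → R)
    (hs : ∀ a : Letter d, g a * g a = 0)
    (hf : ∀ a b : Letter d, a.1 + 1 < b.1 → g a * g b = -(g b * g a))
    (hb : ∀ a b : Letter d, a.1 + 1 = b.1 → g a * g b * g a = g b * g a * g b)
    (w : List (Letter d)) (hw : ¬ IsReduced w) : (w.map g).prod = 0 := by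
  induction w with
  | nil => exact absurd isReduced_nil hw
  | cons a u ih =>
    rw [List.map_cons, List.prod_cons]
    by_cases ru : IsReduced u
    · have hd : (wordPerm u)⁻¹ (hi a) < (wordPerm u)⁻¹ (lo a) := by
        rcases inv_simple_mul_cases a (wordPerm u) with h | h
        · exact absurd (isReduced_cons a u ru h.1) hw
        · exact h.1
      obtain ⟨x, hx, rx⟩ := exists_reduced (simple a * wordPerm u)
      obtain ⟨r1, p1⟩ := isReduced_cons_of_descent a x _ hd rx hx
      have := prod_eq_or_neg g hf hb u (a :: x) ru r1 p1.symm
      rw [List.map_cons, List.prod_cons] at this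
      rcases this with h | h <;> rw [h] <;> simp [← mul_assoc, hs]
    · rw [ih ru, mul_zero]

/-! ### The algebra of strand crossings -/

/-- The free algebra on the letters: the module of formal combinations of words, with
concatenation as the product. -/
abbrev Words (k : Type*) [CommRing k] (d : ℕ) : Type _ := MonoidAlgebra k (FreeMonoid (Letter d))

/-- A word as an element of the free algebra. -/
noncomputable def word (k : Type*) [CommRing k] {d : ℕ} (w : List (Letter d)) : Words k d :=
  MonoidAlgebra.of k _ (FreeMonoid.ofList w)

theorem word_nil (k : Type*) [CommRing k] {d : ℕ} : word k ([] : List (Letter d)) = 1 :=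
  map_one _

theorem word_append (k : Type*) [CommRing k] {d : ℕ} (u v : List (Letter d)) :
    word k (u ++ v) = word k u * word k v := by
  rw [word, FreeMonoid.ofList_append, map_mul]; rfl

theorem word_cons (k : Type*) [CommRing k] {d : ℕ} (a : Letter d) (v : List (Letter d)) :
    word k (a :: v) = word k [a] * word k v := word_append k [a] v

theorem word_eq_prod (k : Type*) [CommRing k] {d : ℕ} (w : List (Letter d)) :
    word k w = (w.map fun a => word k [a]).prod := by
  induction w with
  | nil => exact word_nil k
  | cons a w ih => rw [word_cons, ih, List.map_cons, List.prod_cons]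

/-- The linear map with prescribed values on words. -/
noncomputable def wordLift {k M : Type*} [CommRing k] [AddCommGroup M] [Module k M] {d : ℕ}
    (f : List (Letter d) → M) : Words k d →ₗ[k] M :=
  Finsupp.linearCombination k (fun w : FreeMonoid (Letter d) => f w.toList) ∘ₗ
    (MonoidAlgebra.coeffLinearEquiv k).toLinearMap

@[simp] theorem wordLift_word {k M : Type*} [CommRing k] [AddCommGroup M] [Module k M] {d : ℕ}
    (f : List (Letter d) → M) (w : List (Letter d)) : wordLift f (word k w) = f w := by
  simp [wordLift, word]

theorem words_ext {k M : Type*} [CommRing k] [AddCommGroup M] [Module k M] {d : ℕ}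
    {f g : Words k d →ₗ[k] M} (h : ∀ w, f (word k w) = g (word k w)) : f = g := by
  refine MonoidAlgebra.lhom_ext' fun w => LinearMap.ext_ring ?_
  exact h w.toList

/-- The signed sum of the words obtained from a word by deleting one letter, that is, by resolving
one crossing. Words are read from right to left, so the crossings that happen after a letter are
the ones to the left of it. -/
noncomputable def resolve (k : Type*) [CommRing k] {d : ℕ} (w : List (Letter d)) : Words k d :=
  ∑ i ∈ Finset.range w.length, (-1 : k) ^ i • word k (w.eraseIdx i)

/-- The linear extension of `resolve`. -/
noncomputable def wordsDiff (k : Type*) [CommRing k] (d : ℕ) : Words k d →ₗ[k] Words k d :=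
  wordLift (resolve k)

theorem resolve_cons (k : Type*) [CommRing k] {d : ℕ} (a : Letter d) (w : List (Letter d)) :
    resolve k (a :: w) = word k w - word k [a] * resolve k w := by
  rw [resolve, List.length_cons, Finset.sum_range_succ', resolve, Finset.mul_sum, add_comm,
    sub_eq_add_neg, ← Finset.sum_neg_distrib]
  congr 1
  · simp
  · refine Finset.sum_congr rfl fun i _ => ?_
    rw [List.eraseIdx_cons_succ, word_cons, mul_smul_comm, pow_succ, mul_neg_one, neg_smul]

theorem wordsDiff_one (k : Type*) [CommRing k] (d : ℕ) : wordsDiff k d 1 = 0 := by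
  rw [← word_nil, wordsDiff, wordLift_word, resolve]; simp

theorem wordsDiff_letter (k : Type*) [CommRing k] {d : ℕ} (a : Letter d) :
    wordsDiff k d (word k [a]) = 1 := by
  rw [wordsDiff, wordLift_word, resolve]; simp [word_nil]

theorem wordsDiff_letter_mul (k : Type*) [CommRing k] {d : ℕ} (a : Letter d) (y : Words k d) :
    wordsDiff k d (word k [a] * y) = y - word k [a] * wordsDiff k d y := by
  have : wordsDiff k d ∘ₗ LinearMap.mulLeft k (word k [a]) =
      LinearMap.id - LinearMap.mulLeft k (word k [a]) ∘ₗ wordsDiff k d := by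
    refine words_ext fun w => ?_
    simp only [LinearMap.comp_apply, LinearMap.mulLeft_apply, LinearMap.sub_apply,
      LinearMap.id_apply]
    rw [← word_cons, wordsDiff, wordLift_word, wordLift_word, resolve_cons]
  exact LinearMap.congr_fun this y

theorem wordsDiff_word_mul (k : Type*) [CommRing k] {d : ℕ} (u : List (Letter d))
    (y : Words k d) : wordsDiff k d (word k u * y) =
      wordsDiff k d (word k u) * y + (-1 : k) ^ u.length • (word k u * wordsDiff k d y) := by
  induction u with
  | nil => simp [word_nil, wordsDiff_one]
  | cons a u ih =>
    rw [word_cons, mul_assoc, wordsDiff_letter_mul, ih, wordsDiff_letter_mul, List.length_cons,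
      pow_succ, mul_neg_one, neg_smul, mul_add, mul_smul_comm, sub_mul, mul_assoc, mul_assoc]
    abel

theorem wordsDiff_wordsDiff (k : Type*) [CommRing k] {d : ℕ} (x : Words k d) :
    wordsDiff k d (wordsDiff k d x) = 0 := by
  have : wordsDiff k d ∘ₗ wordsDiff k d = 0 := by
    refine words_ext fun w => ?_
    rw [LinearMap.comp_apply, LinearMap.zero_apply]
    induction w with
    | nil => rw [word_nil, wordsDiff_one, map_zero]
    | cons a w ih =>
      rw [word_cons, wordsDiff_letter_mul, map_sub, wordsDiff_letter_mul, ih, mul_zero, sub_zero,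
        sub_self]
  exact LinearMap.congr_fun this x

/-- The relations between words of crossings:
* a word whose strand diagram has two strands that cross more than once vanishes;
* moving a crossing past a distant one changes the sign;
* sliding a strand over a crossing does not change the sign. -/
def relators (k : Type*) [CommRing k] (d : ℕ) : Set (Words k d) :=
  {x | ∃ w : List (Letter d), ¬ IsReduced w ∧ x = word k w} ∪
  {x | ∃ a b : Letter d, a.1 + 1 < b.1 ∧ x = word k [a, b] + word k [b, a]} ∪
  {x | ∃ a b : Letter d, a.1 + 1 = b.1 ∧ x = word k [a, b, a] - word k [b, a, b]}

/-- The two-sided ideal generated by the relations between words of crossings. -/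
noncomputable def relIdeal (k : Type*) [CommRing k] (d : ℕ) : TwoSidedIdeal (Words k d) :=
  TwoSidedIdeal.span (relators k d)

/-- The algebra of crossings of `d` strands: the `k`-module spanned by the reduced words, modulo
the relations that compare reduced words of the same permutation. The product of two reduced words
is their concatenation if that is reduced, and zero otherwise. -/
def Crossings (k : Type*) [CommRing k] (d : ℕ) : Type _ := Words k d ⧸ (relIdeal k d).asIdeal

noncomputable instance (k : Type*) [CommRing k] (d : ℕ) : Ring (Crossings k d) :=
  inferInstanceAs (Ring (Words k d ⧸ (relIdeal k d).asIdeal))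

noncomputable instance (k : Type*) [CommRing k] (d : ℕ) : Algebra k (Crossings k d) :=
  inferInstanceAs (Algebra k (Words k d ⧸ (relIdeal k d).asIdeal))

/-- The projection of the free algebra to the algebra of crossings. -/
noncomputable def mkCrossings (k : Type*) [CommRing k] (d : ℕ) : Words k d →ₐ[k] Crossings k d :=
  Ideal.Quotient.mkₐ k (relIdeal k d).asIdeal

theorem mkCrossings_surjective (k : Type*) [CommRing k] (d : ℕ) :
    Function.Surjective (mkCrossings k d) := Ideal.Quotient.mkₐ_surjective k _

theorem mkCrossings_eq_zero_iff {k : Type*} [CommRing k] {d : ℕ} {x : Words k d} :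
    mkCrossings k d x = 0 ↔ x ∈ relIdeal k d := by
  rw [← TwoSidedIdeal.mem_asIdeal]
  exact Ideal.Quotient.eq_zero_iff_mem

/-- A variant of the relations, in which only double crossings of neighbours are set to zero. -/
def relatorsSq (k : Type*) [CommRing k] (d : ℕ) : Set (Words k d) :=
  {x | ∃ a : Letter d, x = word k [a, a]} ∪
  {x | ∃ a b : Letter d, a.1 + 1 < b.1 ∧ x = word k [a, b] + word k [b, a]} ∪
  {x | ∃ a b : Letter d, a.1 + 1 = b.1 ∧ x = word k [a, b, a] - word k [b, a, b]}

theorem word_mem_relatorsSq (k : Type*) [CommRing k] {d : ℕ} (w : List (Letter d))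
    (hw : ¬ IsReduced w) : word k w ∈ TwoSidedIdeal.span (relatorsSq k d) := by
  let I := (TwoSidedIdeal.span (relatorsSq k d)).asIdeal
  have mem : ∀ x ∈ relatorsSq k d, Ideal.Quotient.mk I x = 0 := fun x hx =>
    Ideal.Quotient.eq_zero_iff_mem.mpr (TwoSidedIdeal.mem_asIdeal.mpr (TwoSidedIdeal.subset_span hx))
  have key := prod_eq_zero (fun a : Letter d => Ideal.Quotient.mk I (word k [a])) (by
      intro a
      rw [← map_mul, ← word_cons]
      exact mem _ (Or.inl (Or.inl ⟨a, rfl⟩))) (by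
      intro a b hab
      rw [eq_neg_iff_add_eq_zero, ← map_mul, ← map_mul, ← word_cons, ← word_cons, ← map_add]
      exact mem _ (Or.inl (Or.inr ⟨a, b, hab, rfl⟩))) (by
      intro a b hab
      rw [← sub_eq_zero, mul_assoc, mul_assoc]
      simp only [← map_mul]
      rw [← word_cons, ← word_cons, ← word_cons, ← word_cons, ← map_sub]
      exact mem _ (Or.inr ⟨a, b, hab, rfl⟩)) w hw
  have h2 : Ideal.Quotient.mk I (word k w) = 0 := by
    rw [word_eq_prod, map_list_prod, List.map_map]
    exact key
  exact TwoSidedIdeal.mem_asIdeal.mp (Ideal.Quotient.eq_zero_iff_mem.mp h2)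

theorem relIdeal_eq (k : Type*) [CommRing k] (d : ℕ) :
    relIdeal k d = TwoSidedIdeal.span (relatorsSq k d) := by
  apply le_antisymm
  · refine TwoSidedIdeal.span_le.mpr ?_
    rintro x ((⟨w, hw, rfl⟩ | h) | h)
    · exact word_mem_relatorsSq k w hw
    · exact TwoSidedIdeal.subset_span (Or.inl (Or.inr h))
    · exact TwoSidedIdeal.subset_span (Or.inr h)
  · refine TwoSidedIdeal.span_mono ?_
    rintro x ((⟨a, rfl⟩ | h) | h)
    · refine Or.inl (Or.inl ⟨[a, a], ?_, rfl⟩)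
      intro h
      have h2 : wordPerm [a, a] = 1 := by simp [simple_mul_self]
      rw [IsReduced, h2, inv_one] at h
      simp at h
    · exact Or.inl (Or.inr h)
    · exact Or.inr h

open scoped Pointwise in
/-- A linear map vanishes on a two-sided ideal if it vanishes on the generators multiplied by words
on both sides. -/
theorem linear_eq_zero_of_mem {k M : Type*} [CommRing k] [AddCommGroup M] [Module k M] {d : ℕ}
    (S : Set (Words k d)) (f : Words k d →ₗ[k] M)
    (h : ∀ u v : List (Letter d), ∀ r ∈ S, f (word k u * r * word k v) = 0)
    (x : Words k d) (hx : x ∈ TwoSidedIdeal.span S) : f x = 0 := by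
  rw [TwoSidedIdeal.mem_span_iff_mem_addSubgroup_closure] at hx
  have hle : AddSubgroup.closure ((Set.univ : Set (Words k d)) * S * Set.univ) ≤
      (LinearMap.ker f).toAddSubgroup := by
    rw [AddSubgroup.closure_le]
    rintro _ ⟨_, ⟨a, -, r, hr, rfl⟩, b, -, rfl⟩
    change f (a * r * b) = 0
    have h1 : ∀ u : List (Letter d), f ∘ₗ LinearMap.mulLeft k (word k u * r) = 0 := fun u =>
      words_ext fun v => h u v r hr
    have h2 : f ∘ₗ LinearMap.mulRight k (r * b) = 0 := words_ext fun u => by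
      have := LinearMap.congr_fun (h1 u) b
      simpa [mul_assoc] using this
    have := LinearMap.congr_fun h2 a
    simpa [mul_assoc] using this
  exact hle hx

/-- The linear map on the algebra of crossings induced by a linear map that respects the
relations. -/
noncomputable def liftCrossings {k M : Type*} [CommRing k] [AddCommGroup M] [Module k M] {d : ℕ}
    (f : Words k d →ₗ[k] M) (h : ∀ x ∈ relIdeal k d, f x = 0) : Crossings k d →ₗ[k] M :=
  ((relIdeal k d).asIdeal.restrictScalars k).liftQ f (fun x hx => h x hx) ∘ₗ
    (Submodule.Quotient.restrictScalarsEquiv k (relIdeal k d).asIdeal).symm.toLinearMap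

/-- The class of a word in the algebra of crossings. -/
noncomputable def diag (k : Type*) [CommRing k] {d : ℕ} (w : List (Letter d)) : Crossings k d :=
  mkCrossings k d (word k w)

@[simp] theorem liftCrossings_mk {k M : Type*} [CommRing k] [AddCommGroup M] [Module k M] {d : ℕ}
    (f : Words k d →ₗ[k] M) (h : ∀ x ∈ relIdeal k d, f x = 0) (x : Words k d) :
    liftCrossings f h (mkCrossings k d x) = f x := rfl

@[simp] theorem liftCrossings_diag {k M : Type*} [CommRing k] [AddCommGroup M] [Module k M] {d : ℕ}
    (f : Words k d →ₗ[k] M) (h : ∀ x ∈ relIdeal k d, f x = 0) (w : List (Letter d)) :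
    liftCrossings f h (diag k w) = f (word k w) := rfl

theorem mkCrossings_eq_zero {k : Type*} [CommRing k] {d : ℕ} {x : Words k d}
    (hx : x ∈ TwoSidedIdeal.span (relatorsSq k d)) : mkCrossings k d x = 0 := by
  rw [mkCrossings_eq_zero_iff, relIdeal_eq]
  exact hx

theorem wordsDiff_relatorsSq {k : Type*} [CommRing k] {d : ℕ} {r : Words k d}
    (hr : r ∈ relatorsSq k d) : wordsDiff k d r ∈ TwoSidedIdeal.span (relatorsSq k d) := by
  have e1 : ∀ a : Letter d, wordsDiff k d (word k [a]) = 1 := wordsDiff_letter k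
  have e2 : ∀ a b : Letter d, wordsDiff k d (word k [a, b]) = word k [b] - word k [a] := by
    intro a b
    rw [word_cons, wordsDiff_letter_mul, e1, mul_one]
  have e3 : ∀ a b c : Letter d, wordsDiff k d (word k [a, b, c]) =
      word k [b, c] - word k [a, c] + word k [a, b] := by
    intro a b c
    rw [word_cons, wordsDiff_letter_mul, e2, mul_sub, ← word_cons, ← word_cons]
    abel
  rcases hr with (⟨a, rfl⟩ | ⟨a, b, -, rfl⟩) | ⟨a, b, -, rfl⟩
  · rw [e2, sub_self]; exact zero_mem _
  · rw [map_add, e2, e2, sub_add_sub_cancel, sub_self]; exact zero_mem _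
  · rw [map_sub, e3, e3]
    have : word k [b, a] - word k [a, a] + word k [a, b] -
        (word k [a, b] - word k [b, b] + word k [b, a]) = word k [b, b] - word k [a, a] := by abel
    rw [this]
    exact sub_mem (TwoSidedIdeal.subset_span (Or.inl (Or.inl ⟨b, rfl⟩)))
      (TwoSidedIdeal.subset_span (Or.inl (Or.inl ⟨a, rfl⟩)))

theorem relatorsSq_homogeneous {k : Type*} [CommRing k] {d : ℕ} {r : Words k d}
    (hr : r ∈ relatorsSq k d) :
    ∃ l : ℕ, r ∈ Submodule.span k (word k '' {w : List (Letter d) | w.length = l}) := by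
  have h : ∀ w : List (Letter d), ∀ l, w.length = l →
      word k w ∈ Submodule.span k (word k '' {w : List (Letter d) | w.length = l}) :=
    fun w l hw => Submodule.subset_span ⟨w, hw, rfl⟩
  rcases hr with (⟨a, rfl⟩ | ⟨a, b, -, rfl⟩) | ⟨a, b, -, rfl⟩
  · exact ⟨2, h _ _ rfl⟩
  · exact ⟨2, add_mem (h _ _ rfl) (h _ _ rfl)⟩
  · exact ⟨3, sub_mem (h _ _ rfl) (h _ _ rfl)⟩

theorem wordsDiff_mul_of_homogeneous {k : Type*} [CommRing k] {d : ℕ} {l : ℕ} {r : Words k d}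
    (hr : r ∈ Submodule.span k (word k '' {w : List (Letter d) | w.length = l})) (y : Words k d) :
    wordsDiff k d (r * y) = wordsDiff k d r * y + (-1 : k) ^ l • (r * wordsDiff k d y) := by
  induction hr using Submodule.span_induction with
  | mem x hx => obtain ⟨w, rfl, rfl⟩ := hx; exact wordsDiff_word_mul k w y
  | zero => simp
  | add x z _ _ hx hz => simp only [add_mul, map_add, hx, hz, smul_add]; abel
  | smul c x _ hx =>
    simp only [smul_mul_assoc, map_smul, hx, smul_add]
    rw [smul_comm]

theorem mkCrossings_wordsDiff {k : Type*} [CommRing k] {d : ℕ} (x : Words k d)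
    (hx : x ∈ relIdeal k d) : ((mkCrossings k d).toLinearMap ∘ₗ wordsDiff k d) x = 0 := by
  rw [relIdeal_eq] at hx
  refine linear_eq_zero_of_mem _ _ ?_ x hx
  intro u v r hr
  refine mkCrossings_eq_zero ?_
  have m0 := TwoSidedIdeal.subset_span hr
  obtain ⟨l, hl⟩ := relatorsSq_homogeneous hr
  rw [mul_assoc, wordsDiff_word_mul, wordsDiff_mul_of_homogeneous hl]
  have sm : ∀ (c : k) (z : Words k d), z ∈ TwoSidedIdeal.span (relatorsSq k d) →
      c • z ∈ TwoSidedIdeal.span (relatorsSq k d) := by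
    intro c z hz
    rw [Algebra.smul_def]
    exact TwoSidedIdeal.mul_mem_left _ _ _ hz
  refine add_mem (TwoSidedIdeal.mul_mem_left _ _ _ (TwoSidedIdeal.mul_mem_right _ _ _ m0))
    (sm _ _ (TwoSidedIdeal.mul_mem_left _ _ _ (add_mem
      (TwoSidedIdeal.mul_mem_right _ _ _ (wordsDiff_relatorsSq hr))
      (sm _ _ (TwoSidedIdeal.mul_mem_right _ _ _ m0)))))

/-- The differential of the algebra of crossings: the signed sum of the resolutions of a single
crossing, where resolutions in which two strands cross more than once vanish. -/
noncomputable def crossingsDiff (k : Type*) [CommRing k] (d : ℕ) :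
    Crossings k d →ₗ[k] Crossings k d :=
  liftCrossings ((mkCrossings k d).toLinearMap ∘ₗ wordsDiff k d) mkCrossings_wordsDiff

/-- The part of cohomological degree `p` of the algebra of crossings: it is spanned by the reduced
words with `-p` letters. -/
noncomputable def crossingsGr (k : Type*) [CommRing k] (d : ℕ) (p : ℤ) :
    Submodule k (Crossings k d) :=
  Submodule.span k (diag k '' {w : List (Letter d) | IsReduced w ∧ -(w.length : ℤ) = p})

theorem diag_nil (k : Type*) [CommRing k] {d : ℕ} : diag k ([] : List (Letter d)) = 1 := by
  rw [diag, word_nil, map_one]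

theorem diag_append (k : Type*) [CommRing k] {d : ℕ} (u v : List (Letter d)) :
    diag k (u ++ v) = diag k u * diag k v := by
  rw [diag, word_append, map_mul]; rfl

theorem diag_eq_zero (k : Type*) [CommRing k] {d : ℕ} (w : List (Letter d)) (h : ¬ IsReduced w) :
    diag k w = 0 :=
  mkCrossings_eq_zero_iff.mpr (TwoSidedIdeal.subset_span (Or.inl (Or.inl ⟨w, h, rfl⟩)))

theorem crossingsDiff_diag (k : Type*) [CommRing k] {d : ℕ} (w : List (Letter d)) :
    crossingsDiff k d (diag k w) =
      ∑ i ∈ Finset.range w.length, (-1 : k) ^ i • diag k (w.eraseIdx i) := by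
  rw [crossingsDiff, liftCrossings_diag, LinearMap.comp_apply, wordsDiff, wordLift_word, resolve,
    map_sum]
  exact Finset.sum_congr rfl fun i _ => map_smul (mkCrossings k d) _ _

theorem crossings_ext {k M : Type*} [CommRing k] [AddCommGroup M] [Module k M] {d : ℕ}
    {f g : Crossings k d →ₗ[k] M} (h : ∀ w, f (diag k w) = g (diag k w)) : f = g := by
  have : f ∘ₗ (mkCrossings k d).toLinearMap = g ∘ₗ (mkCrossings k d).toLinearMap := words_ext h
  refine LinearMap.ext fun x => ?_
  obtain ⟨x, rfl⟩ := mkCrossings_surjective k d x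
  exact LinearMap.congr_fun this x

theorem crossingsDiff_diff {k : Type*} [CommRing k] {d : ℕ} (x : Crossings k d) :
    crossingsDiff k d (crossingsDiff k d x) = 0 := by
  obtain ⟨x, rfl⟩ := mkCrossings_surjective k d x
  change mkCrossings k d (wordsDiff k d (wordsDiff k d x)) = 0
  rw [wordsDiff_wordsDiff, map_zero]

theorem crossingsDiff_mul {k : Type*} [CommRing k] {d : ℕ} {p : ℤ} {x : Crossings k d}
    (hx : x ∈ crossingsGr k d p) (y : Crossings k d) :
    crossingsDiff k d (x * y) =
      crossingsDiff k d x * y + p.negOnePow • (x * crossingsDiff k d y) := by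
  induction hx using Submodule.span_induction with
  | mem x hx =>
    obtain ⟨w, ⟨hw, rfl⟩, rfl⟩ := hx
    obtain ⟨y, rfl⟩ := mkCrossings_surjective k d y
    have e : ∀ z : Words k d, crossingsDiff k d (mkCrossings k d z) =
        mkCrossings k d (wordsDiff k d z) := fun _ => rfl
    rw [diag, ← map_mul, e, e, e, wordsDiff_word_mul, map_add, map_mul, Int.negOnePow_neg,
      Int.negOnePow_def, zpow_natCast]
    rcases Nat.even_or_odd w.length with h | h
    · rw [h.neg_one_pow, h.neg_one_pow, one_smul, one_smul, map_mul]
    · rw [h.neg_one_pow, h.neg_one_pow, neg_one_smul, Units.neg_smul, one_smul, map_neg, map_mul]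
  | zero => simp
  | add x z _ _ hx hz => simp only [add_mul, map_add, hx, hz, smul_add]; abel
  | smul c x _ hx =>
    simp only [smul_mul_assoc, map_smul, hx, smul_add]
    rw [smul_comm]

theorem crossingsGr_mul {k : Type*} [CommRing k] {d : ℕ} {p q : ℤ} {x y : Crossings k d}
    (hx : x ∈ crossingsGr k d p) (hy : y ∈ crossingsGr k d q) :
    x * y ∈ crossingsGr k d (p + q) := by
  induction hx using Submodule.span_induction with
  | zero => simp
  | add x z _ _ hx hz => rw [add_mul]; exact add_mem hx hz
  | smul c x _ hx => rw [smul_mul_assoc]; exact Submodule.smul_mem _ _ hx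
  | mem x hx =>
    obtain ⟨u, ⟨hu, rfl⟩, rfl⟩ := hx
    induction hy using Submodule.span_induction with
    | zero => simp
    | add x z _ _ hx hz => rw [mul_add]; exact add_mem hx hz
    | smul c x _ hx => rw [mul_smul_comm]; exact Submodule.smul_mem _ _ hx
    | mem y hy =>
      obtain ⟨v, ⟨hv, rfl⟩, rfl⟩ := hy
      rw [← diag_append]
      by_cases h : IsReduced (u ++ v)
      · refine Submodule.subset_span ⟨_, ⟨h, ?_⟩, rfl⟩
        rw [List.length_append]; push_cast; ring
      · rw [diag_eq_zero k _ h]; exact zero_mem _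

theorem crossingsDiff_mem {k : Type*} [CommRing k] {d : ℕ} {p : ℤ} {x : Crossings k d}
    (hx : x ∈ crossingsGr k d p) : crossingsDiff k d x ∈ crossingsGr k d (p + 1) := by
  induction hx using Submodule.span_induction with
  | zero => simp
  | add x z _ _ hx hz => rw [map_add]; exact add_mem hx hz
  | smul c x _ hx => rw [map_smul]; exact Submodule.smul_mem _ _ hx
  | mem x hx =>
    obtain ⟨w, ⟨hw, rfl⟩, rfl⟩ := hx
    rw [crossingsDiff_diag]
    refine Submodule.sum_mem _ fun i hi => Submodule.smul_mem _ _ ?_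
    have hi' := Finset.mem_range.mp hi
    by_cases h : IsReduced (w.eraseIdx i)
    · refine Submodule.subset_span ⟨_, ⟨h, ?_⟩, rfl⟩
      rw [List.length_eraseIdx_of_lt hi']; omega
    · rw [diag_eq_zero k _ h]; exact zero_mem _

/-- The projection of the free algebra to the words with `-p` letters. -/
noncomputable def wordsProj (k : Type*) [CommRing k] (d : ℕ) (p : ℤ) : Words k d →ₗ[k] Words k d :=
  wordLift fun w => if -(w.length : ℤ) = p then word k w else 0

theorem wordsProj_homogeneous {k : Type*} [CommRing k] {d : ℕ} {l : ℕ} {r : Words k d}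
    (hr : r ∈ Submodule.span k (word k '' {w : List (Letter d) | w.length = l})) (p : ℤ) :
    wordsProj k d p r = if -(l : ℤ) = p then r else 0 := by
  induction hr using Submodule.span_induction with
  | zero => simp
  | add x z _ _ hx hz => rw [map_add, hx, hz]; split_ifs <;> simp
  | smul c x _ hx => rw [map_smul, hx]; split_ifs <;> simp
  | mem x hx => obtain ⟨w, rfl, rfl⟩ := hx; rw [wordsProj, wordLift_word]

theorem mkCrossings_wordsProj {k : Type*} [CommRing k] {d : ℕ} (p : ℤ) (x : Words k d)
    (hx : x ∈ relIdeal k d) : ((mkCrossings k d).toLinearMap ∘ₗ wordsProj k d p) x = 0 := by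
  rw [relIdeal_eq] at hx
  refine linear_eq_zero_of_mem _ _ ?_ x hx
  intro u v r hr
  refine mkCrossings_eq_zero ?_
  have m0 := TwoSidedIdeal.subset_span hr
  obtain ⟨l, hl⟩ := relatorsSq_homogeneous hr
  have h2 : word k u * r * word k v ∈ Submodule.span k
      (word k '' {w : List (Letter d) | w.length = u.length + l + v.length}) := by
    clear hr m0
    induction hl using Submodule.span_induction with
    | zero => simp
    | add x z _ _ hx hz => rw [mul_add, add_mul]; exact add_mem hx hz
    | smul c x _ hx => rw [mul_smul_comm, smul_mul_assoc]; exact Submodule.smul_mem _ _ hx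
    | mem x hx =>
      obtain ⟨w, rfl, rfl⟩ := hx
      rw [← word_append, ← word_append]
      exact Submodule.subset_span ⟨_, by simp [add_assoc], rfl⟩
  rw [wordsProj_homogeneous h2]
  split_ifs
  · exact TwoSidedIdeal.mul_mem_right _ _ _ (TwoSidedIdeal.mul_mem_left _ _ _ m0)
  · exact zero_mem _

/-- The projection of the algebra of crossings to its part of degree `p`. -/
noncomputable def crossingsProj (k : Type*) [CommRing k] (d : ℕ) (p : ℤ) :
    Crossings k d →ₗ[k] Crossings k d :=
  liftCrossings ((mkCrossings k d).toLinearMap ∘ₗ wordsProj k d p) (mkCrossings_wordsProj p)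

theorem crossingsProj_diag (k : Type*) [CommRing k] {d : ℕ} (p : ℤ) (w : List (Letter d)) :
    crossingsProj k d p (diag k w) = if -(w.length : ℤ) = p then diag k w else 0 := by
  rw [crossingsProj, liftCrossings_diag, LinearMap.comp_apply, wordsProj, wordLift_word]
  split_ifs
  · rfl
  · exact map_zero _

theorem crossings_mem_of_diag {k M : Type*} [CommRing k] [AddCommGroup M] [Module k M] {d : ℕ}
    (f : Crossings k d →ₗ[k] M) (N : Submodule k M) (h : ∀ w, IsReduced w → f (diag k w) ∈ N)
    (x : Crossings k d) : f x ∈ N := by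
  have : N.mkQ ∘ₗ f = 0 := crossings_ext fun w => by
    by_cases hw : IsReduced w
    · simpa using h w hw
    · simp [diag_eq_zero k w hw]
  simpa using LinearMap.congr_fun this x

theorem crossingsProj_mem {k : Type*} [CommRing k] {d : ℕ} (p : ℤ) (x : Crossings k d) :
    crossingsProj k d p x ∈ crossingsGr k d p := by
  refine crossings_mem_of_diag _ _ (fun w hw => ?_) x
  rw [crossingsProj_diag]
  split_ifs with h
  · exact Submodule.subset_span ⟨w, ⟨hw, h⟩, rfl⟩
  · exact zero_mem _

theorem crossingsProj_of_mem {k : Type*} [CommRing k] {d : ℕ} (p q : ℤ) (x : Crossings k d)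
    (hx : x ∈ crossingsGr k d q) : crossingsProj k d p x = if q = p then x else 0 := by
  induction hx using Submodule.span_induction with
  | zero => simp
  | add x z _ _ hx hz => rw [map_add, hx, hz]; split_ifs <;> simp
  | smul c x _ hx => rw [map_smul, hx]; split_ifs <;> simp
  | mem x hx => obtain ⟨w, ⟨_, rfl⟩, rfl⟩ := hx; rw [crossingsProj_diag]

theorem crossingsProj_sum {k : Type*} [CommRing k] {d : ℕ} (x : Crossings k d) :
    ∑ p ∈ Finset.Icc (-((d * d : ℕ) : ℤ)) 0, crossingsProj k d p x = x := by
  have : ∑ p ∈ Finset.Icc (-((d * d : ℕ) : ℤ)) 0, crossingsProj k d p = LinearMap.id := by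
    refine crossings_ext fun w => ?_
    rw [LinearMap.sum_apply, LinearMap.id_apply]
    by_cases hw : IsReduced w
    · simp only [crossingsProj_diag]
      rw [Finset.sum_ite_eq, if_pos]
      have := hw.length_le
      rw [Finset.mem_Icc]
      constructor <;> omega
    · simp [diag_eq_zero k w hw]
  have h := LinearMap.congr_fun this x
  rwa [LinearMap.sum_apply] at h

/-! ### The strands algebra -/

/-- The `d`-element subsets `i_1 < ⋯ < i_d` of a set of `n` places, as increasing tuples. The order
is the product order. -/
abbrev Places (n d : ℕ) : Type := {I : Fin d → Fin n // StrictMono I}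

noncomputable instance (n d : ℕ) : Fintype (Places n d) := Fintype.ofFinite _

/-- There are strand diagrams from `I` to `J` with the underlying permutation `π`: all strands,
which connect `i_a` to `j_{π(a)}`, move weakly upwards. -/
def Admissible {n d : ℕ} (I J : Places n d) (π : Equiv.Perm (Fin d)) : Prop :=
  ∀ a : Fin d, I.1 a ≤ J.1 (π a)

/-- The module of strand diagrams from `I` to `J`, spanned by the reduced words whose permutation
is admissible. All relations of `Crossings` compare reduced words of one and the same permutation or
set non-reduced words to zero, so that this submodule carries no relations other than those between
strand diagrams from `I` to `J`. -/
noncomputable def strandHom (k : Type*) [CommRing k] {n d : ℕ} (I J : Places n d) :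
    Submodule k (Crossings k d) :=
  Submodule.span k (diag k '' {w : List (Letter d) | IsReduced w ∧ Admissible I J (wordPerm w)})

theorem strandHom_one {k : Type*} [CommRing k] {n d : ℕ} (I : Places n d) :
    (1 : Crossings k d) ∈ strandHom k I I := by
  rw [← diag_nil]
  exact Submodule.subset_span ⟨[], ⟨isReduced_nil, fun a => le_rfl⟩, rfl⟩

theorem strandHom_mul {k : Type*} [CommRing k] {n d : ℕ} {I J K : Places n d} {x y : Crossings k d}
    (hx : x ∈ strandHom k J K) (hy : y ∈ strandHom k I J) : x * y ∈ strandHom k I K := by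
  induction hx using Submodule.span_induction with
  | zero => simp
  | add x z _ _ hx hz => rw [add_mul]; exact add_mem hx hz
  | smul c x _ hx => rw [smul_mul_assoc]; exact Submodule.smul_mem _ _ hx
  | mem x hx =>
    obtain ⟨u, ⟨hu, hu'⟩, rfl⟩ := hx
    induction hy using Submodule.span_induction with
    | zero => simp
    | add x z _ _ hx hz => rw [mul_add]; exact add_mem hx hz
    | smul c x _ hx => rw [mul_smul_comm]; exact Submodule.smul_mem _ _ hx
    | mem y hy =>
      obtain ⟨v, ⟨hv, hv'⟩, rfl⟩ := hy
      rw [← diag_append]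
      by_cases h : IsReduced (u ++ v)
      · refine Submodule.subset_span ⟨_, ⟨h, fun a => ?_⟩, rfl⟩
        rw [wordPerm_append]
        exact (hv' a).trans (hu' _)
      · rw [diag_eq_zero k _ h]; exact zero_mem _

theorem Admissible.resolve {n d : ℕ} {I J : Places n d} {u v : List (Letter d)} {a : Letter d}
    (hw : IsReduced (u ++ a :: v)) (h : Admissible I J (wordPerm (u ++ a :: v))) :
    Admissible I J (wordPerm (u ++ v)) := by
  have h1 : (wordPerm v)⁻¹ (lo a) < (wordPerm v)⁻¹ (hi a) := hw.right.ascent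
  have h2 : wordPerm u (lo a) < wordPerm u (hi a) := by
    have hr : IsReduced (u ++ [a]) := by
      rw [List.append_cons] at hw; exact hw.left
    have hu := hr.left
    unfold IsReduced at hr hu
    rw [wordPerm_append, List.length_append, ← inv_inv', mul_inv_rev] at hr
    rw [← inv_inv'] at hu
    have e : (wordPerm [a])⁻¹ = simple a := by simp [simple_inv]
    rw [e, List.length_singleton] at hr
    rcases inv_simple_mul_cases a (wordPerm u)⁻¹ with h' | h'
    · simpa using h'.1
    · omega
  intro x
  rw [wordPerm_append, Equiv.Perm.mul_apply]
  have key : ∀ y, I.1 y ≤ J.1 (wordPerm u (simple a (wordPerm v y))) := by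
    intro y
    have := h y
    rwa [wordPerm_append, wordPerm_cons, Equiv.Perm.mul_apply, Equiv.Perm.mul_apply] at this
  by_cases hl : wordPerm v x = lo a
  · have hx : x = (wordPerm v)⁻¹ (lo a) := (Equiv.Perm.inv_eq_iff_eq.mpr hl.symm).symm
    have := key ((wordPerm v)⁻¹ (hi a))
    rw [show wordPerm v ((wordPerm v)⁻¹ (hi a)) = hi a by simp, simple_hi] at this
    rw [hl, hx]
    exact (I.2 h1).le.trans this
  · by_cases hh : wordPerm v x = hi a
    · have := key x
      rw [hh, simple_hi] at this
      rw [hh]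
      exact this.trans (J.2 h2).le
    · have := key x
      rwa [simple_of_ne a _ hl hh] at this

theorem strandHom_diff {k : Type*} [CommRing k] {n d : ℕ} {I J : Places n d} {x : Crossings k d}
    (hx : x ∈ strandHom k I J) : crossingsDiff k d x ∈ strandHom k I J := by
  induction hx using Submodule.span_induction with
  | zero => simp
  | add x z _ _ hx hz => rw [map_add]; exact add_mem hx hz
  | smul c x _ hx => rw [map_smul]; exact Submodule.smul_mem _ _ hx
  | mem x hx =>
    obtain ⟨w, ⟨hw, hw'⟩, rfl⟩ := hx
    rw [crossingsDiff_diag]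
    refine Submodule.sum_mem _ fun i hi => Submodule.smul_mem _ _ ?_
    have hi' := Finset.mem_range.mp hi
    by_cases h : IsReduced (w.eraseIdx i)
    · refine Submodule.subset_span ⟨_, ⟨h, ?_⟩, rfl⟩
      have e : w = w.take i ++ w[i] :: w.drop (i + 1) := by
        rw [← List.drop_eq_getElem_cons hi', List.take_append_drop]
      rw [List.eraseIdx_eq_take_drop_succ]
      rw [e] at hw hw'
      exact Admissible.resolve hw hw'
    · rw [diag_eq_zero k _ h]; exact zero_mem _

theorem strandHom_proj {k : Type*} [CommRing k] {n d : ℕ} {I J : Places n d} {x : Crossings k d}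
    (p : ℤ) (hx : x ∈ strandHom k I J) : crossingsProj k d p x ∈ strandHom k I J := by
  induction hx using Submodule.span_induction with
  | zero => simp
  | add x z _ _ hx hz => rw [map_add]; exact add_mem hx hz
  | smul c x _ hx => rw [map_smul]; exact Submodule.smul_mem _ _ hx
  | mem x hx =>
    obtain ⟨w, hw, rfl⟩ := hx
    rw [crossingsProj_diag]
    split_ifs
    · exact Submodule.subset_span ⟨w, hw, rfl⟩
    · exact zero_mem _

/-- The underlying algebra of the strands algebra with `d` strands and `n` places. Its elements are
the families of elements of the modules of strand diagrams from `I` to `J`, written as matrices with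
rows `J` and columns `I`, so that the product of matrices is induced by the composition of strand
diagrams. -/
noncomputable def strandsAlgebra (k : Type*) [CommRing k] (n d : ℕ) :
    Subalgebra k (Matrix (Places n d) (Places n d) (Crossings k d)) where
  carrier := {M | ∀ J I, M J I ∈ strandHom k I J}
  add_mem' := fun hx hy J I => add_mem (hx J I) (hy J I)
  mul_mem' := by
    intro x y hx hy K I
    rw [Matrix.mul_apply]
    exact Submodule.sum_mem _ fun J _ => strandHom_mul (hx K J) (hy J I)
  algebraMap_mem' := by
    intro r J I
    rw [Algebra.algebraMap_eq_smul_one, Matrix.smul_apply]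
    refine Submodule.smul_mem _ _ ?_
    by_cases h : J = I
    · subst h
      rw [Matrix.one_apply_eq]
      exact strandHom_one J
    · rw [Matrix.one_apply_ne h]
      exact zero_mem _

/-- A linear map between modules of strand diagrams, applied to all entries. -/
noncomputable def mapStrands {k : Type*} [CommRing k] {n d : ℕ} (f : Crossings k d →ₗ[k] Crossings k d)
    (hf : ∀ (I J : Places n d) (x : Crossings k d), x ∈ strandHom k I J → f x ∈ strandHom k I J) :
    strandsAlgebra k n d →ₗ[k] strandsAlgebra k n d where
  toFun M := ⟨M.1.map f, fun J I => hf I J _ (M.2 J I)⟩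
  map_add' M N := by
    refine Subtype.ext (Matrix.ext fun J I => ?_)
    exact map_add f _ _
  map_smul' c M := by
    refine Subtype.ext (Matrix.ext fun J I => ?_)
    exact map_smul f _ _

/-- The differential graded strands algebra with `d` strands and `n` places: the degree of a strand
diagram is minus its number of crossings, and the differential is the signed sum of the resolutions
of a single crossing. -/
noncomputable def strandsDG (k : Type*) [CommRing k] (n d : ℕ) :
    DGStructure k (strandsAlgebra k n d) where
  gr p :=
    { carrier := {M | ∀ J I, M.1 J I ∈ crossingsGr k d p}
      add_mem' := fun hx hy J I => add_mem (hx J I) (hy J I)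
      zero_mem' := fun _ _ => zero_mem _
      smul_mem' := fun c _ hx J I => Submodule.smul_mem _ c (hx J I) }
  diff := mapStrands (crossingsDiff k d) fun _ _ _ => strandHom_diff
  isInternal := by
    refine DGStructure.isInternal_of_proj _
      (fun p => mapStrands (crossingsProj k d p) fun _ _ _ => strandHom_proj p)
      (Finset.Icc (-((d * d : ℕ) : ℤ)) 0) ?_ ?_ ?_ ?_
    · exact fun p M J I => crossingsProj_mem p _
    · intro p M hM
      refine Subtype.ext (Matrix.ext fun J I => ?_)
      exact (crossingsProj_of_mem p p _ (hM J I)).trans (if_pos rfl)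
    · intro p q M hpq hM
      refine Subtype.ext (Matrix.ext fun J I => ?_)
      exact (crossingsProj_of_mem p q _ (hM J I)).trans (if_neg hpq.symm)
    · intro M
      refine Subtype.ext (Matrix.ext fun J I => ?_)
      rw [AddSubmonoidClass.coe_finsetSum, Matrix.sum_apply]
      exact crossingsProj_sum (M.1 J I)
  one_mem := by
    intro J I
    change (1 : Matrix (Places n d) (Places n d) (Crossings k d)) J I ∈ _
    by_cases h : J = I
    · subst h
      rw [Matrix.one_apply_eq, ← diag_nil]
      exact Submodule.subset_span ⟨[], ⟨isReduced_nil, rfl⟩, rfl⟩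
    · rw [Matrix.one_apply_ne h]
      exact zero_mem _
  mul_mem p q M N hM hN K I := by
    change (M.1 * N.1) K I ∈ _
    rw [Matrix.mul_apply]
    exact Submodule.sum_mem _ fun J _ => crossingsGr_mul (hM K J) (hN J I)
  diff_mem p M hM J I := crossingsDiff_mem (hM J I)
  diff_diff M := by
    refine Subtype.ext (Matrix.ext fun J I => ?_)
    exact crossingsDiff_diff _
  leibniz p M N hM := by
    refine Subtype.ext (Matrix.ext fun K I => ?_)
    change crossingsDiff k d ((M.1 * N.1) K I) = (M.1.map (crossingsDiff k d) * N.1) K I +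
      p.negOnePow • (M.1 * N.1.map (crossingsDiff k d)) K I
    rw [Matrix.mul_apply, Matrix.mul_apply, Matrix.mul_apply, map_sum, Finset.smul_sum,
      ← Finset.sum_add_distrib]
    exact Finset.sum_congr rfl fun J _ => crossingsDiff_mul (hM K J) _

/-! ### The higher Auslander algebras of type `A` -/

/-- The incidence algebra of the poset of `d`-element subsets of `n` places: matrices whose entry in
row `J` and column `I` vanishes unless `I ≤ J`. -/
noncomputable def incidenceAlgebra (k : Type*) [CommRing k] (n d : ℕ) :
    Subalgebra k (Matrix (Places n d) (Places n d) k) where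
  carrier := {M | ∀ J I, ¬ I ≤ J → M J I = 0}
  add_mem' := by
    intro x y hx hy J I h
    rw [Matrix.add_apply, hx J I h, hy J I h, add_zero]
  mul_mem' := by
    intro x y hx hy K I h
    rw [Matrix.mul_apply]
    refine Finset.sum_eq_zero fun J _ => ?_
    by_cases h1 : I ≤ J
    · rw [hx K J fun h2 => h (h1.trans h2), zero_mul]
    · rw [hy J I h1, mul_zero]
  algebraMap_mem' := by
    intro r J I h
    rw [Matrix.algebraMap_matrix_apply, if_neg]
    rintro rfl
    exact h le_rfl

/-- The basis element `f_{JI}` of the incidence algebra, for `I ≤ J`. -/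
noncomputable def incidenceBasis (k : Type*) [CommRing k] {n d : ℕ} (I J : Places n d) (h : I ≤ J) :
    incidenceAlgebra k n d :=
  ⟨Matrix.single J I 1, fun J' I' h' => by
    refine Matrix.single_apply_of_ne _ _ _ _ _ ?_
    rintro ⟨rfl, rfl⟩
    exact h' h⟩

/-- The two-sided ideal of the incidence algebra generated by the basis elements `f_{JI}` such that
`j_a ≥ i_{a+1}` for some `a`. -/
noncomputable def auslanderIdeal (k : Type*) [CommRing k] (n d : ℕ) : TwoSidedIdeal (incidenceAlgebra k n d) :=
  TwoSidedIdeal.span {x | ∃ (I J : Places n d) (h : I ≤ J),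
    (∃ (a : ℕ) (ha : a + 1 < d), I.1 ⟨a + 1, ha⟩ ≤ J.1 ⟨a, (Nat.lt_succ_self a).trans ha⟩) ∧
    x = incidenceBasis k I J h}

/-- The `d`-dimensional Auslander algebra of type `A_{n-d+1}`. -/
abbrev AuslanderAlgebra (k : Type*) [CommRing k] (n d : ℕ) : Type _ :=
  incidenceAlgebra k n d ⧸ (auslanderIdeal k n d).asIdeal

end Strands

/-!
For a pair `(I, J)` of tuples of places, let `s_a` be a simple transposition with `i_{a+1} ≤ j_a`.

* If such an `a` exists, take the largest one. Then multiplication by `s_a` from the left preserves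
  the set of admissible permutations (`Admissible.simple_mul`), and hence the complex `hom(I, J)`.
  Since `∂(s_a x) = x - s_a ∂x` (`crossingsDiff_letter_mul`), it is a contracting homotopy, and
  `hom(I, J)` is acyclic.
* If there is none, every admissible permutation satisfies `π(x) ≥ x` for all `x` and is therefore
  the identity (`Admissible.eq_one`), so that `hom(I, J)` is contained in `k · 1`; it is all of
  `k · 1` if `I ≤ J`, and zero otherwise.

So the cohomology is concentrated in degree zero. All elements of degree zero are cocycles, and they
are the matrices with entries in `k · 1` that vanish unless `I ≤ J`, that is, the elements of the
incidence algebra (`incidenceToCocycles`). For `I ≤ J`, the entry `1` in position `(J, I)` is a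
coboundary if `i_{a+1} ≤ j_a` for some `a`, being `∂ s_a`; if there is no such `a`, the only
coboundary in position `(J, I)` is zero. This identifies the coboundaries with the ideal that defines the Auslander algebra.

The morphism to `H^0` comes from the augmentation of the algebra of crossings, the algebra
homomorphism to `k` that sends all letters to zero.
-/

/-! ### Differential graded algebras with cohomology in degree zero -/

theorem DGHom.isQuasiIso_of_cocycle {k A : Type*} [CommRing k] [Ring A] [Algebra k A]
    {D : DGStructure k A} (f : DGHom D (DGStructure.concentrated k D.H0))
    (hD : ∀ p : ℤ, p ≠ 0 → Subsingleton (D.cohomology p))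
    (hf : ∀ z : D.zeroCocycles, f.toAlgHom z = Ideal.Quotient.mk D.zeroCoboundaries z) :
    f.IsQuasiIso := by
  intro p
  by_cases hp : p = 0
  · subst hp
    constructor
    · rw [injective_iff_map_eq_zero]
      intro x hx
      obtain ⟨⟨z, hz⟩, rfl⟩ := Submodule.Quotient.mk_surjective _ x
      obtain ⟨y, -, hy⟩ := (Submodule.Quotient.mk_eq_zero _).mp hx
      -- the differential of `H^0` is zero, so that `f z` is zero
      have hfz : (0 : D.H0) = f.toAlgHom z := hy
      have h0 : Ideal.Quotient.mk D.zeroCoboundaries ⟨z, hz⟩ = 0 :=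
        (hf ⟨z, hz⟩).symm.trans hfz.symm
      exact (Submodule.Quotient.mk_eq_zero _).mpr (Ideal.Quotient.eq_zero_iff_mem.mp h0)
    · intro y
      obtain ⟨⟨y, hy⟩, rfl⟩ := Submodule.Quotient.mk_surjective _ y
      obtain ⟨z, rfl⟩ := Ideal.Quotient.mk_surjective y
      exact ⟨Submodule.Quotient.mk ⟨z.1, z.2⟩,
        congrArg Submodule.Quotient.mk (Subtype.ext (hf z))⟩
  · have := hD p hp
    refine ⟨Function.injective_of_subsingleton _, fun y => ⟨0, ?_⟩⟩
    obtain ⟨⟨y, hy⟩, rfl⟩ := Submodule.Quotient.mk_surjective _ y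
    have hy0 : y = 0 := by simpa [DGStructure.concentrated, hp] using hy.1
    subst hy0
    exact map_zero _

namespace Strands

/-! ### Admissible permutations -/

/-- Some crossing of two adjacent strands is admissible from `I` to `J`, up to the condition
`I ≤ J`: these are the pairs that index the relations of the Auslander algebra. -/
def CanCross {n d : ℕ} (I J : Places n d) : Prop :=
  ∃ a : Letter d, I.1 (hi a) ≤ J.1 (lo a)

theorem admissible_one_iff {n d : ℕ} {I J : Places n d} : Admissible I J 1 ↔ I ≤ J := Iff.rfl

/-- Left multiplication by the last simple transposition with `i_{a+1} ≤ j_a` preserves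
admissibility. -/
theorem Admissible.simple_mul {n d : ℕ} {I J : Places n d} {a : Letter d}
    (ha : I.1 (hi a) ≤ J.1 (lo a)) (hmax : ∀ b : Letter d, a < b → J.1 (lo b) < I.1 (hi b))
    {π : Equiv.Perm (Fin d)} (h : Admissible I J π) : Admissible I J (simple a * π) := by
  intro x
  rw [Equiv.Perm.mul_apply]
  by_cases hl : π x = lo a
  · rw [hl, simple_lo]
    exact (hl ▸ h x).trans (J.2 (lo_lt_hi a)).le
  by_cases hh : π x = hi a
  · rw [hh, simple_hi]
    refine le_trans (I.2.monotone ?_) ha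
    by_contra! hx
    have hx' : a.1 + 1 < x.1 := hx
    have hxd := x.2
    let b : Letter d := ⟨a.1 + 1, by omega⟩
    have hb : hi b ≤ x := hx'
    have h1 : J.1 (hi a) < I.1 (hi b) := hmax b (Nat.lt_succ_self a.1)
    exact absurd (hh ▸ h x) (not_le.mpr (h1.trans_le (I.2.monotone hb)))
  · rw [simple_of_ne a _ hl hh]
    exact h x

theorem CanCross.exists_simple_mul {n d : ℕ} {I J : Places n d} (h : CanCross I J) :
    ∃ a : Letter d, ∀ π, Admissible I J π → Admissible I J (simple a * π) := by
  obtain ⟨a, ha, hmax⟩ := {a : Letter d | I.1 (hi a) ≤ J.1 (lo a)}.toFinite.exists_maximal h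
  exact ⟨a, fun π => Admissible.simple_mul ha fun b hab => lt_of_not_ge fun hb =>
    not_le_of_gt hab (hmax hb hab.le)⟩

theorem Admissible.eq_one {n d : ℕ} {I J : Places n d} (hIJ : ¬ CanCross I J)
    {π : Equiv.Perm (Fin d)} (h : Admissible I J π) : π = 1 := by
  have hle : ∀ x, x.1 ≤ (π x).1 := by
    intro x
    by_contra! hx
    have hxd := x.2
    let b : Letter d := ⟨(π x).1, by omega⟩
    exact hIJ ⟨b, (I.2.monotone (show hi b ≤ x from hx)).trans (h x)⟩
  -- the values of `π` have the same sum as those of the identity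
  have hsum : ∑ x : Fin d, x.1 = ∑ x : Fin d, (π x).1 := (Equiv.sum_comp π Fin.val).symm
  ext x
  exact ((Finset.sum_eq_sum_iff_of_le fun x _ => hle x).mp hsum x (Finset.mem_univ x)).symm

theorem IsReduced.eq_nil {d : ℕ} {w : List (Letter d)} (hw : IsReduced w) (h : wordPerm w = 1) :
    w = [] := by
  rw [IsReduced, h, inv_one] at hw
  exact List.length_eq_zero_iff.mp hw

/-! ### The augmentation of the algebra of crossings -/

/-- The algebra homomorphism from the free algebra to `k` that sends all letters to zero. -/
noncomputable def wordsAug (k : Type*) [CommRing k] (d : ℕ) : Words k d →ₐ[k] k :=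
  MonoidAlgebra.lift k k _ (FreeMonoid.lift fun _ => 0)

theorem wordsAug_word {k : Type*} [CommRing k] {d : ℕ} {w : List (Letter d)} (hw : w ≠ []) :
    wordsAug k d (word k w) = 0 := by
  obtain ⟨a, u, rfl⟩ := List.exists_cons_of_ne_nil hw
  have : wordsAug k d (word k [a]) = 0 := by simp [wordsAug, word]
  rw [word_cons, map_mul, this, zero_mul]

theorem wordsAug_relIdeal {k : Type*} [CommRing k] {d : ℕ} {x : Words k d}
    (hx : x ∈ relIdeal k d) : wordsAug k d x = 0 := by
  refine (TwoSidedIdeal.mem_ker (f := wordsAug k d)).mp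
    ((TwoSidedIdeal.span_le (I := TwoSidedIdeal.ker (wordsAug k d))).mpr ?_ hx)
  intro x hx
  rw [SetLike.mem_coe, TwoSidedIdeal.mem_ker]
  rcases hx with (⟨w, hw, rfl⟩ | ⟨a, b, -, rfl⟩) | ⟨a, b, -, rfl⟩
  · exact wordsAug_word fun h => hw (h ▸ isReduced_nil)
  · rw [map_add, wordsAug_word (by simp), wordsAug_word (by simp), add_zero]
  · rw [map_sub, wordsAug_word (by simp), wordsAug_word (by simp), sub_zero]

/-- The algebra homomorphism from the algebra of crossings to `k` that sends all letters to
zero. -/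
noncomputable def augmentation (k : Type*) [CommRing k] (d : ℕ) : Crossings k d →ₐ[k] k :=
  Ideal.Quotient.liftₐ (relIdeal k d).asIdeal (wordsAug k d) fun _ hx => wordsAug_relIdeal hx

theorem augmentation_diag {k : Type*} [CommRing k] {d : ℕ} {w : List (Letter d)} (hw : w ≠ []) :
    augmentation k d (diag k w) = 0 := wordsAug_word hw

theorem augmentation_of_mem {k : Type*} [CommRing k] {d : ℕ} {p : ℤ} (hp : p ≠ 0)
    {x : Crossings k d} (hx : x ∈ crossingsGr k d p) : augmentation k d x = 0 := by
  induction hx using Submodule.span_induction with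
  | zero => exact map_zero _
  | add x z _ _ hx hz => rw [map_add, hx, hz, add_zero]
  | smul c x _ hx => rw [map_smul, hx, smul_zero]
  | mem x hx =>
    obtain ⟨w, ⟨-, rfl⟩, rfl⟩ := hx
    exact augmentation_diag (by rintro rfl; simp at hp)

theorem algebraMap_augmentation {k : Type*} [CommRing k] {d : ℕ} {x : Crossings k d}
    (hx : x ∈ crossingsGr k d 0) : algebraMap k _ (augmentation k d x) = x := by
  induction hx using Submodule.span_induction with
  | zero => rw [map_zero, map_zero]
  | add x z _ _ hx hz => rw [map_add, map_add, hx, hz]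
  | smul c x _ hx => rw [map_smul, smul_eq_mul, map_mul, hx, ← Algebra.smul_def]
  | mem x hx =>
    obtain ⟨w, ⟨-, hw⟩, rfl⟩ := hx
    obtain rfl : w = [] := List.length_eq_zero_iff.mp (by simpa using hw)
    rw [diag_nil, map_one, map_one]

theorem algebraMap_mem_crossingsGr {k : Type*} [CommRing k] {d : ℕ} (c : k) :
    algebraMap k (Crossings k d) c ∈ crossingsGr k d 0 := by
  rw [Algebra.algebraMap_eq_smul_one, ← diag_nil]
  exact Submodule.smul_mem _ _ (Submodule.subset_span ⟨[], ⟨isReduced_nil, rfl⟩, rfl⟩)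

theorem crossingsDiff_algebraMap {k : Type*} [CommRing k] {d : ℕ} (c : k) :
    crossingsDiff k d (algebraMap k _ c) = 0 := by
  rw [Algebra.algebraMap_eq_smul_one, map_smul, ← diag_nil, crossingsDiff_diag]
  simp

theorem crossingsDiff_of_mem_zero {k : Type*} [CommRing k] {d : ℕ} {x : Crossings k d}
    (hx : x ∈ crossingsGr k d 0) : crossingsDiff k d x = 0 := by
  rw [← algebraMap_augmentation hx, crossingsDiff_algebraMap]

/-! ### The modules of strand diagrams -/

theorem diag_letter_mem {k : Type*} [CommRing k] {d : ℕ} (a : Letter d) :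
    diag k [a] ∈ crossingsGr k d (-1) := by
  refine Submodule.subset_span ⟨[a], ⟨isReduced_cons a [] isReduced_nil ?_, rfl⟩, rfl⟩
  simpa using lo_lt_hi a

theorem crossingsDiff_letter_mul {k : Type*} [CommRing k] {d : ℕ} (a : Letter d)
    (x : Crossings k d) :
    crossingsDiff k d (diag k [a] * x) = x - diag k [a] * crossingsDiff k d x := by
  have h : crossingsDiff k d (diag k [a]) = 1 := by
    rw [crossingsDiff_diag]
    simp [diag_nil]
  rw [crossingsDiff_mul (diag_letter_mem a), h, one_mul, sub_eq_add_neg]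
  simp

theorem letter_mul_mem_strandHom {k : Type*} [CommRing k] {n d : ℕ} {I J : Places n d}
    {a : Letter d} (ha : ∀ π, Admissible I J π → Admissible I J (simple a * π))
    {x : Crossings k d} (hx : x ∈ strandHom k I J) : diag k [a] * x ∈ strandHom k I J := by
  induction hx using Submodule.span_induction with
  | zero => simp
  | add x z _ _ hx hz => rw [mul_add]; exact add_mem hx hz
  | smul c x _ hx => rw [mul_smul_comm]; exact Submodule.smul_mem _ _ hx
  | mem x hx =>
    obtain ⟨w, ⟨-, hw⟩, rfl⟩ := hx
    rw [← diag_append, List.singleton_append]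
    by_cases h : IsReduced (a :: w)
    · refine Submodule.subset_span ⟨_, ⟨h, ?_⟩, rfl⟩
      rw [wordPerm_cons]
      exact ha _ hw
    · rw [diag_eq_zero k _ h]; exact zero_mem _

theorem strandHom_le_crossingsGr {k : Type*} [CommRing k] {n d : ℕ} {I J : Places n d}
    (hIJ : ¬ CanCross I J) : strandHom k I J ≤ crossingsGr k d 0 := by
  refine Submodule.span_mono (Set.image_mono ?_)
  rintro w ⟨hw, h⟩
  exact ⟨hw, by simp [hw.eq_nil (h.eq_one hIJ)]⟩

theorem augmentation_strandHom {k : Type*} [CommRing k] {n d : ℕ} {I J : Places n d}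
    (hIJ : ¬ I ≤ J) {x : Crossings k d} (hx : x ∈ strandHom k I J) :
    augmentation k d x = 0 := by
  induction hx using Submodule.span_induction with
  | zero => exact map_zero _
  | add x z _ _ hx hz => rw [map_add, hx, hz, add_zero]
  | smul c x _ hx => rw [map_smul, hx, smul_zero]
  | mem x hx =>
    obtain ⟨w, ⟨-, hw⟩, rfl⟩ := hx
    refine augmentation_diag ?_
    rintro rfl
    exact hIJ (admissible_one_iff.mp hw)

theorem one_mem_strandHom {k : Type*} [CommRing k] {n d : ℕ} {I J : Places n d} (h : I ≤ J) :
    (1 : Crossings k d) ∈ strandHom k I J := by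
  rw [← diag_nil]
  exact Submodule.subset_span ⟨[], ⟨isReduced_nil, admissible_one_iff.mpr h⟩, rfl⟩

theorem exists_crossingsDiff_eq_one {k : Type*} [CommRing k] {n d : ℕ} {I J : Places n d}
    (hIJ : I ≤ J) (h : CanCross I J) :
    ∃ y ∈ strandHom k I J, y ∈ crossingsGr k d (-1) ∧ crossingsDiff k d y = 1 := by
  obtain ⟨a, ha⟩ := h.exists_simple_mul
  have hmem := letter_mul_mem_strandHom ha (one_mem_strandHom (k := k) hIJ)
  rw [mul_one] at hmem
  refine ⟨_, hmem, diag_letter_mem a, ?_⟩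
  have h1 := crossingsDiff_algebraMap (d := d) (1 : k)
  rw [map_one] at h1
  simpa [h1] using crossingsDiff_letter_mul (k := k) a 1

/-- The modules of strand diagrams have no cohomology outside degree zero. -/
theorem strandHom_exact {k : Type*} [CommRing k] {n d : ℕ} (I J : Places n d) {p : ℤ}
    (hp : p ≠ 0) {x : Crossings k d} (hx : x ∈ strandHom k I J) (hxp : x ∈ crossingsGr k d p)
    (hx0 : crossingsDiff k d x = 0) :
    ∃ y ∈ strandHom k I J, y ∈ crossingsGr k d (p - 1) ∧ crossingsDiff k d y = x := by
  by_cases hIJ : CanCross I J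
  · obtain ⟨a, ha⟩ := hIJ.exists_simple_mul
    refine ⟨_, letter_mul_mem_strandHom ha hx, ?_, ?_⟩
    · rw [show p - 1 = -1 + p by ring]
      exact crossingsGr_mul (diag_letter_mem a) hxp
    · rw [crossingsDiff_letter_mul, hx0, mul_zero, sub_zero]
  · have : x = 0 := by
      rw [← algebraMap_augmentation (strandHom_le_crossingsGr hIJ hx),
        augmentation_of_mem hp hxp, map_zero]
    subst this
    exact ⟨0, zero_mem _, zero_mem _, map_zero _⟩

/-! ### Cohomology of the strands algebra -/

theorem strandsDG_exact {k : Type*} [CommRing k] {n d : ℕ} {p : ℤ} (hp : p ≠ 0)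
    {M : strandsAlgebra k n d} (hM : M ∈ (strandsDG k n d).cocycles p) :
    M ∈ (strandsDG k n d).coboundaries p := by
  have hd : (strandsDG k n d).diff M = 0 := hM.2
  have h0 : ∀ J I, crossingsDiff k d (M.1 J I) = 0 := fun J I =>
    congrFun (congrFun (congrArg Subtype.val hd) J) I
  choose y hy hyp hyd using fun J I => strandHom_exact I J hp (M.2 J I) (hM.1 J I) (h0 J I)
  exact ⟨⟨Matrix.of y, hy⟩, hyp, Subtype.ext (Matrix.ext hyd)⟩

theorem subsingleton_cohomology {k : Type*} [CommRing k] {n d : ℕ} {p : ℤ} (hp : p ≠ 0) :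
    Subsingleton ((strandsDG k n d).cohomology p) := by
  refine Submodule.Quotient.subsingleton_iff.mpr (eq_top_iff.mpr ?_)
  rintro ⟨M, hM⟩ -
  exact strandsDG_exact hp hM

theorem mem_zeroCocycles {k : Type*} [CommRing k] {n d : ℕ} {M : strandsAlgebra k n d}
    (hM : M ∈ (strandsDG k n d).gr 0) : M ∈ (strandsDG k n d).zeroCocycles :=
  ⟨hM, Subtype.ext (Matrix.ext fun J I => crossingsDiff_of_mem_zero (hM J I))⟩

/-- The elements of the incidence algebra as cocycles of degree zero of the strands algebra: the
basis element `f_{JI}` goes to the strand diagram from `I` to `J` without crossings. -/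
noncomputable def incidenceToCocycles (k : Type*) [CommRing k] (n d : ℕ) :
    incidenceAlgebra k n d →ₐ[k] (strandsDG k n d).zeroCocycles :=
  AlgHom.codRestrict
    (AlgHom.codRestrict ((Algebra.ofId k (Crossings k d)).mapMatrix.comp
        (incidenceAlgebra k n d).val) (strandsAlgebra k n d) (by
      intro M J I
      change algebraMap k (Crossings k d) (M.1 J I) ∈ _
      by_cases h : I ≤ J
      · rw [Algebra.algebraMap_eq_smul_one]
        exact Submodule.smul_mem _ _ (one_mem_strandHom h)
      · rw [M.2 J I h, map_zero]
        exact zero_mem _))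
    _ fun M => mem_zeroCocycles fun J I => algebraMap_mem_crossingsGr (M.1 J I)

theorem incidenceToCocycles_apply {k : Type*} [CommRing k] {n d : ℕ}
    (M : incidenceAlgebra k n d) (J I : Places n d) :
    (incidenceToCocycles k n d M).1.1 J I = algebraMap k _ (M.1 J I) := rfl

/-- The augmentation, applied to all entries of a matrix of strand diagrams. -/
noncomputable def strandsToIncidence (k : Type*) [CommRing k] (n d : ℕ) :
    strandsAlgebra k n d →ₐ[k] incidenceAlgebra k n d :=
  AlgHom.codRestrict ((augmentation k d).mapMatrix.comp (strandsAlgebra k n d).val) _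
    fun M J I h => augmentation_strandHom h (M.2 J I)

theorem strandsToIncidence_apply {k : Type*} [CommRing k] {n d : ℕ}
    (M : strandsAlgebra k n d) (J I : Places n d) :
    (strandsToIncidence k n d M).1 J I = augmentation k d (M.1 J I) := rfl

theorem strandsToIncidence_of_mem {k : Type*} [CommRing k] {n d : ℕ} {p : ℤ} (hp : p ≠ 0)
    {M : strandsAlgebra k n d} (hM : M ∈ (strandsDG k n d).gr p) :
    strandsToIncidence k n d M = 0 :=
  Subtype.ext (Matrix.ext fun J I => augmentation_of_mem hp (hM J I))

theorem incidenceToCocycles_strandsToIncidence {k : Type*} [CommRing k] {n d : ℕ}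
    (z : (strandsDG k n d).zeroCocycles) :
    incidenceToCocycles k n d (strandsToIncidence k n d z) = z :=
  Subtype.ext (Subtype.ext (Matrix.ext fun J I => algebraMap_augmentation (z.2.1 J I)))

/-- The class in `H^0` of the cocycle that an element of the incidence algebra defines. -/
noncomputable def incidenceToH0 (k : Type*) [CommRing k] (n d : ℕ) :
    incidenceAlgebra k n d →ₐ[k] (strandsDG k n d).H0 :=
  (Ideal.Quotient.mkₐ k _).comp (incidenceToCocycles k n d)

theorem incidenceToH0_strandsToIncidence {k : Type*} [CommRing k] {n d : ℕ}
    (z : (strandsDG k n d).zeroCocycles) :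
    incidenceToH0 k n d (strandsToIncidence k n d z) =
      Ideal.Quotient.mk (strandsDG k n d).zeroCoboundaries z := by
  rw [incidenceToH0, AlgHom.comp_apply, incidenceToCocycles_strandsToIncidence]
  rfl

theorem incidenceToH0_surjective {k : Type*} [CommRing k] {n d : ℕ} :
    Function.Surjective (incidenceToH0 k n d) := by
  intro y
  obtain ⟨z, rfl⟩ := Ideal.Quotient.mk_surjective y
  exact ⟨_, incidenceToH0_strandsToIncidence z⟩

theorem incidenceToH0_eq_zero_iff {k : Type*} [CommRing k] {n d : ℕ}
    {M : incidenceAlgebra k n d} : incidenceToH0 k n d M = 0 ↔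
      (incidenceToCocycles k n d M).1 ∈ (strandsDG k n d).coboundaries 0 :=
  Ideal.Quotient.eq_zero_iff_mem

/-! ### Comparison with the Auslander algebra -/

theorem canCross_iff {n d : ℕ} {I J : Places n d} : CanCross I J ↔
    ∃ (a : ℕ) (ha : a + 1 < d), I.1 ⟨a + 1, ha⟩ ≤ J.1 ⟨a, (Nat.lt_succ_self a).trans ha⟩ :=
  ⟨fun ⟨a, h⟩ => ⟨a.1, by have := a.2; omega, h⟩, fun ⟨a, ha, h⟩ => ⟨⟨a, by omega⟩, h⟩⟩

theorem incidenceToH0_incidenceBasis {k : Type*} [CommRing k] {n d : ℕ} {I J : Places n d}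
    (hIJ : I ≤ J) (h : CanCross I J) : incidenceToH0 k n d (incidenceBasis k I J hIJ) = 0 := by
  classical
  obtain ⟨y, hy, hy1, hyd⟩ := exists_crossingsDiff_eq_one (k := k) hIJ h
  rw [incidenceToH0_eq_zero_iff]
  have hmem : ∀ (N : Submodule k (Crossings k d)) (J' I' : Places n d),
      (J = J' ∧ I = I' → y ∈ N) → Matrix.single J I y J' I' ∈ N := by
    intro N J' I' hN
    rw [Matrix.single_apply]
    split_ifs with h
    · exact hN h
    · exact zero_mem _
  refine ⟨⟨Matrix.single J I y, fun J' I' => hmem _ J' I' ?_⟩,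
    fun J' I' => hmem _ J' I' fun _ => hy1, Subtype.ext (Matrix.ext fun J' I' => ?_)⟩
  · rintro ⟨rfl, rfl⟩
    exact hy
  · rw [incidenceToCocycles_apply]
    change crossingsDiff k d (Matrix.single J I y J' I') =
      algebraMap k _ (Matrix.single J I 1 J' I')
    rw [Matrix.single_apply, Matrix.single_apply]
    split_ifs
    · rw [hyd, map_one]
    · rw [map_zero, map_zero]

theorem mem_auslanderIdeal_of_apply_eq_zero {k : Type*} [CommRing k] {n d : ℕ}
    {M : incidenceAlgebra k n d} (hM : ∀ J I, ¬ CanCross I J → M.1 J I = 0) :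
    M ∈ auslanderIdeal k n d := by
  classical
  have hsum : M = ∑ J, ∑ I, if h : I ≤ J then M.1 J I • incidenceBasis k I J h else 0 := by
    refine Subtype.ext ?_
    rw [AddSubmonoidClass.coe_finsetSum]
    conv_lhs => rw [Matrix.matrix_eq_sum_single M.1]
    refine Finset.sum_congr rfl fun J _ => ?_
    rw [AddSubmonoidClass.coe_finsetSum]
    refine Finset.sum_congr rfl fun I _ => ?_
    split_ifs with h
    · change _ = M.1 J I • Matrix.single J I (1 : k)
      rw [Matrix.smul_single, smul_eq_mul, mul_one]
    · rw [M.2 J I h, Matrix.single_zero]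
      rfl
  rw [hsum]
  refine sum_mem fun J _ => sum_mem fun I _ => ?_
  split_ifs with h
  · by_cases hc : CanCross I J
    · rw [Algebra.smul_def]
      exact TwoSidedIdeal.mul_mem_left _ _ _
        (TwoSidedIdeal.subset_span ⟨I, J, h, canCross_iff.mp hc, rfl⟩)
    · rw [hM J I hc, zero_smul]
      exact zero_mem _
  · exact zero_mem _

theorem ker_incidenceToH0 {k : Type*} [CommRing k] {n d : ℕ} :
    RingHom.ker (incidenceToH0 k n d) = (auslanderIdeal k n d).asIdeal := by
  ext M
  rw [RingHom.mem_ker, TwoSidedIdeal.mem_asIdeal]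
  constructor
  · intro h
    obtain ⟨N, -, hN⟩ := incidenceToH0_eq_zero_iff.mp h
    refine mem_auslanderIdeal_of_apply_eq_zero fun J I hc => ?_
    have hJI : crossingsDiff k d (N.1 J I) = algebraMap k _ (M.1 J I) :=
      congrFun (congrFun (congrArg Subtype.val hN) J) I
    rw [crossingsDiff_of_mem_zero (strandHom_le_crossingsGr hc (N.2 J I))] at hJI
    -- the augmentation splits `algebraMap`, which is therefore injective
    simpa using (congrArg (augmentation k d) hJI).symm
  · intro h
    refine (TwoSidedIdeal.mem_ker (f := incidenceToH0 k n d)).mp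
      ((TwoSidedIdeal.span_le (I := TwoSidedIdeal.ker (incidenceToH0 k n d))).mpr ?_ h)
    rintro _ ⟨I, J, hIJ, hc, rfl⟩
    rw [SetLike.mem_coe, TwoSidedIdeal.mem_ker]
    exact incidenceToH0_incidenceBasis hIJ (canCross_iff.mpr hc)

/-- The target of a surjective homomorphism as the quotient by its kernel. -/
noncomputable def algEquivQuotientOfKerEq {k A C : Type*} [CommRing k] [Ring A] [Algebra k A]
    [Ring C] [Algebra k C] (f : A →ₐ[k] C) (hf : Function.Surjective f) {I : Ideal A}
    [I.IsTwoSided] (hI : RingHom.ker f = I) : C ≃ₐ[k] A ⧸ I :=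
  (Ideal.quotientKerAlgEquivOfSurjective hf).symm.trans (Ideal.quotientEquivAlgOfEq k hI)

/-- The algebra `H^0` of the strands algebra is the Auslander algebra. -/
noncomputable def h0EquivAuslander (k : Type*) [CommRing k] (n d : ℕ) :
    (strandsDG k n d).H0 ≃ₐ[k] AuslanderAlgebra k n d :=
  algEquivQuotientOfKerEq (incidenceToH0 k n d) incidenceToH0_surjective ker_incidenceToH0

/-! ### The quasi-isomorphism -/

theorem incidenceToH0_strandsToIncidence_diff {k : Type*} [CommRing k] {n d : ℕ}
    (M : strandsAlgebra k n d) :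
    incidenceToH0 k n d (strandsToIncidence k n d ((strandsDG k n d).diff M)) = 0 := by
  have hM : M ∈ ⨆ p, (strandsDG k n d).gr p := by
    rw [(strandsDG k n d).isInternal.submodule_iSup_eq_top]
    trivial
  induction hM using Submodule.iSup_induction' with
  | zero => simp
  | add x y _ _ hx hy => rw [map_add, map_add, map_add, hx, hy, add_zero]
  | mem p x hx =>
    have hdx := (strandsDG k n d).diff_mem p x hx
    by_cases hp : p = -1
    · subst hp
      rw [incidenceToH0_strandsToIncidence ⟨_, mem_zeroCocycles hdx⟩,
        Ideal.Quotient.eq_zero_iff_mem]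
      exact ⟨x, hx, rfl⟩
    · rw [strandsToIncidence_of_mem (by omega) hdx, map_zero]

/-- The morphism of differential graded algebras to `H^0` that vanishes in non-zero degrees and
sends a cocycle of degree zero to its class. -/
noncomputable def toH0 (k : Type*) [CommRing k] (n d : ℕ) :
    DGHom (strandsDG k n d) (DGStructure.concentrated k (strandsDG k n d).H0) where
  toAlgHom := (incidenceToH0 k n d).comp (strandsToIncidence k n d)
  map_gr p M hM := by
    by_cases hp : p = 0
    · simp [DGStructure.concentrated, hp]
    · rw [AlgHom.comp_apply, strandsToIncidence_of_mem hp hM, map_zero]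
      exact zero_mem _
  map_diff M := incidenceToH0_strandsToIncidence_diff M

theorem toH0_cocycle {k : Type*} [CommRing k] {n d : ℕ} (z : (strandsDG k n d).zeroCocycles) :
    (toH0 k n d).toAlgHom z = Ideal.Quotient.mk (strandsDG k n d).zeroCoboundaries z :=
  incidenceToH0_strandsToIncidence z

theorem toH0_isQuasiIso {k : Type*} [CommRing k] {n d : ℕ} : (toH0 k n d).IsQuasiIso :=
  DGHom.isQuasiIso_of_cocycle _ (fun _ => subsingleton_cohomology) toH0_cocycle

end Strands

theorem mainTheorem4 {k : Type*} [CommRing k] (n d : ℕ) (hd : 1 ≤ d) (hdn : d ≤ n) :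
    (∀ p : ℤ, p ≠ 0 → Subsingleton ((Strands.strandsDG k n d).cohomology p)) ∧
    (∃ f : DGHom (Strands.strandsDG k n d)
        (DGStructure.concentrated k (Strands.strandsDG k n d).H0),
      (∀ z : (Strands.strandsDG k n d).zeroCocycles,
        f.toAlgHom z = Ideal.Quotient.mk (Strands.strandsDG k n d).zeroCoboundaries z) ∧
      f.IsQuasiIso) ∧
    Nonempty ((Strands.strandsDG k n d).H0 ≃ₐ[k] Strands.AuslanderAlgebra k n d) := by
  exact ⟨fun p hp => Strands.subsingleton_cohomology hp,
    ⟨Strands.toH0 k n d, Strands.toH0_cocycle, Strands.toH0_isQuasiIso⟩,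
    ⟨Strands.h0EquivAuslander k n d⟩⟩
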